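/- **Definitions.** Write $S^d$ for the unit sphere of $\mathbb{R}^{d+1}$ and $\hom^+(S^d)$ for the connected component of the identity in the space of self-homeomorphisms of $S^d$ with the topology of uniform convergence. For $a\in\mathbb{R}^{d+1}$ let $\operatorname{aim}(a):S^d\to\{+,0,-\}$, $x\mapsto\operatorname{sign}\langle a,x\rangle$. A *pseudosphere* on $S^d$ is a map $\theta:S^d\to\{+,0,-\}$ with $\theta\circ\varphi=\operatorname{aim}(e_{d+1})$ for some $\varphi\in\hom^+(S^d)$ (on $S^0$ both orientations $\pm\operatorname{aim}(e_1)$ are admitted when it occurs as a member of an arrangement). A family $(\theta_i)_{i}$ of sign maps on $S^d$ is a *pseudosphere arrangement* if every $\theta_i$ is a pseudosphere or identically zero and, for every set $I$ of indices, $S_I=\bigcap_{i\in I}\theta_i^{-1}(0)$ is empty, or all of $S^d$, or there are $e<d$ and a homeomorphism $\varphi_I:S^e\to S_I$ such that $(\theta_i\circ\varphi_I)_i$ is a pseudosphere arrangement on $S^e$. It is *spanning* if $\bigcap_i\theta_i^{-1}(0)=\emptyset$. A *weighted pseudosphere* (of rank 3) is a pair $\alpha=(r,\theta)$ with $r>0$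 and $\theta$ a pseudosphere on $S^2$, or the trivial one $0=(0,\,x\mapsto 0)$. The distance of $\alpha_1=(r_1,\theta_1)$ and $\alpha_0=(r_0,\theta_0)$ is $$\operatorname{dist}(\alpha_1,\alpha_0)=\inf_{\varphi_1,\varphi_0}\ \sup_{x\in S^2,\ \langle e_3,x\rangle=0}\|r_1\varphi_1(x)-r_0\varphi_0(x)\|,$$ over $\varphi_i\in\hom^+(S^2)$ with $\theta_i\circ\varphi_i=\operatorname{aim}(e_3)$ (all $\varphi_i\in\hom^+(S^2)$ if $\alpha_i=0$). For $n\ge 3$ the *pseudolinear Stiefel manifold* $\mathrm{PV}_{3,n}$ is the space of sequences $A=(\alpha_1,\dots,\alpha_n)$ of weighted pseudospheres $\alpha_i=(r_i,\theta_i)$ for which $(\theta_1,\dots,\theta_n)$ is a spanning pseudosphere arrangement, with the metric $\operatorname{dist}(A,B)=\max_i\operatorname{dist}(\alpha_i,\beta_i)$. Identifying sequences that differ by a tail of zeros, $\mathrm{PV}_{3,\infty}=\bigcup_n\mathrm{PV}_{3,n}$ with the direct limit topology. The orthogonal group $\mathrm{O}_3$ acts on the right by $A*Q=((r_i,\theta_i\circ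 Q))_i$. Put, with quotient topologies, $$\mathrm{PG}_{3,n}=\mathrm{PV}_{3,n}/\mathrm{O}_3,\qquad \widetilde{\mathrm{PG}}_{3,n}=\mathrm{PV}_{3,n}/\mathrm{SO}_3,$$ $$\mathrm{PE}_{3,n}=(\mathrm{PV}_{3,n}\times\mathbb{R}^3)/\mathrm{O}_3,\qquad \widetilde{\mathrm{PE}}_{3,n}=(\mathrm{PV}_{3,n}\times\mathbb{R}^3)/\mathrm{SO}_3,$$ where $Q$ acts on $\mathrm{PV}_{3,n}\times\mathbb{R}^3$ by $(A,x)\mapsto(A*Q,Q^*x)$, and let $\xi_{3,n}:\mathrm{PE}_{3,n}\to\mathrm{PG}_{3,n}$ and $\widetilde\xi_{3,n}:\widetilde{\mathrm{PE}}_{3,n}\to\widetilde{\mathrm{PG}}_{3,n}$ be the projections induced by $(A,x)\mapsto A$. **Lemma.** Let $n\in\{3,4,\dots\}$ or $n=\infty$. 1. $\mathrm{PV}_{3,n}$ is a locally trivial principal $\mathrm{O}_3$-bundle over $\mathrm{PG}_{3,n}$: the action of $\mathrm{O}_3$ is continuous and free; the translation function, which sends a pair $(A,B)$ of points of the same orbit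 to the unique $Q$ with $B=A*Q$, is continuous; and every point of $\mathrm{PG}_{3,n}$ has an open neighborhood $U$ over which there is an $\mathrm{O}_3$-equivariant homeomorphism from the preimage of $U$ to $U\times\mathrm{O}_3$ over $U$. 2. $\xi_{3,n}$ is a real vector bundle of rank 3, for the vector space structure on the fibres for which $x\mapsto[A,x]$ is a linear isomorphism from $\mathbb{R}^3$ to the fibre over $[A]$, for all $A\in\mathrm{PV}_{3,n}$. 3. $\widetilde\xi_{3,n}$ is an oriented real vector bundle of rank 3, for the vector space structure and orientation on the fibres for which $x\mapsto[A,x]$ is an orientation preserving linear isomorphism from $\mathbb{R}^3$ to the fibre over $[A]$, for all $A\in\mathrm{PV}_{3,n}$. -/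

import Mathlib

open Set Topology MulOpposite
open scoped ENNReal

noncomputable section

namespace Pseudo

/-! ### Spheres and orientation preserving homeomorphisms -/

/-- The unit sphere `S^d` in `ℝ^(d+1)`; arrangements on it have rank `d + 1`. -/
abbrev Sph (d : ℕ) : Type := Metric.sphere (0 : EuclideanSpace ℝ (Fin (d + 1))) 1

/-- `ℝ³` with its Euclidean inner product. -/
abbrev E3 : Type := EuclideanSpace ℝ (Fin 3)

/-- The sign of the last coordinate: the pseudosphere `aim (e_k)`, `k = d + 1`. -/
def aimLast (d : ℕ) (x : Sph d) : SignType := SignType.sign (x.1 (Fin.last d))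

/-- A homeomorphism of a space, as an element of `C(X, X)` with the compact-open topology. -/
def toC {X : Type*} [TopologicalSpace X] (φ : X ≃ₜ X) : C(X, X) := ⟨φ, φ.continuous⟩

/-- `φ ∈ hom⁺(X)`: the homeomorphism `φ` lies in the connected component of the identity in the
space of self-homeomorphisms. The topology is the compact-open one, which on a compact metric
space is the topology of uniform convergence. -/
def IsPos {X : Type*} [TopologicalSpace X] (φ : X ≃ₜ X) : Prop :=
  toC φ ∈ connectedComponentIn {f : C(X, X) | IsHomeomorph f} (ContinuousMap.id X)

section IsPos
variable {X : Type*} [TopologicalSpace X]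

theorem id_mem_homeos : ContinuousMap.id X ∈ {f : C(X, X) | IsHomeomorph f} :=
  (Homeomorph.refl X).isHomeomorph

theorem IsPos.refl : IsPos (Homeomorph.refl X) := mem_connectedComponentIn id_mem_homeos

/-- If `a ∘ b` is in the component of the identity, then so is `a ∘ φ ∘ b`
for `φ` in that component. -/
theorem IsPos.sandwich {φ : X ≃ₜ X} (hφ : IsPos φ) (a b : X ≃ₜ X) (hab : IsPos (b.trans a)) :
    IsPos ((b.trans φ).trans a) := by
  set F : Set C(X, X) := {f | IsHomeomorph f} with hF
  let T : C(X, X) → C(X, X) := fun g => (toC a).comp (g.comp (toC b))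
  have hT : Continuous T :=
    (ContinuousMap.continuous_postcomp _).comp (ContinuousMap.continuous_precomp _)
  have hsub : T '' connectedComponentIn F (ContinuousMap.id X) ⊆
      connectedComponentIn F (toC (b.trans a)) := by
    refine (isPreconnected_connectedComponentIn.image T hT.continuousOn).subset_connectedComponentIn
      ⟨ContinuousMap.id X, mem_connectedComponentIn id_mem_homeos, rfl⟩ ?_
    rintro _ ⟨g, hg, rfl⟩
    have hg' : IsHomeomorph g := connectedComponentIn_subset F _ hg
    exact a.isHomeomorph.comp (hg'.comp b.isHomeomorph)
  have h2 : toC ((b.trans φ).trans a) ∈ connectedComponentIn F (toC (b.trans a)) :=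
    hsub ⟨toC φ, hφ, rfl⟩
  rw [← connectedComponentIn_eq hab] at h2
  exact h2

theorem IsPos.trans {φ ψ : X ≃ₜ X} (hφ : IsPos φ) (hψ : IsPos ψ) : IsPos (φ.trans ψ) :=
  IsPos.sandwich hφ ψ (Homeomorph.refl X) hψ

theorem IsPos.symm {φ : X ≃ₜ X} (hφ : IsPos φ) : IsPos φ.symm := by
  set F : Set C(X, X) := {f | IsHomeomorph f} with hF
  let T : C(X, X) → C(X, X) := fun g => (toC φ.symm).comp g
  have hT : Continuous T := ContinuousMap.continuous_postcomp _
  have hid : T (toC φ) = ContinuousMap.id X := by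
    ext x; exact φ.symm_apply_apply x
  have hsub : T '' connectedComponentIn F (ContinuousMap.id X) ⊆
      connectedComponentIn F (ContinuousMap.id X) := by
    refine (isPreconnected_connectedComponentIn.image T hT.continuousOn).subset_connectedComponentIn
      ⟨toC φ, hφ, hid⟩ ?_
    rintro _ ⟨g, hg, rfl⟩
    have hg' : IsHomeomorph g := connectedComponentIn_subset F _ hg
    exact φ.symm.isHomeomorph.comp hg'
  exact hsub ⟨ContinuousMap.id X, mem_connectedComponentIn id_mem_homeos, rfl⟩

end IsPos

/-! ### Pseudospheres and pseudosphere arrangements -/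

/-- An oriented pseudosphere: a sign map that some `φ ∈ hom⁺(S^d)` carries to `aim (e_k)`. -/
def IsPseudosphere {d : ℕ} (θ : Sph d → SignType) : Prop :=
  ∃ φ : Sph d ≃ₜ Sph d, IsPos φ ∧ θ ∘ φ = aimLast d

/-- The common kernel `S_I` of the members of a family of sign maps with index in `I`. -/
def commonKer {ι X : Type*} (θ : ι → X → SignType) (I : Set ι) : Set X := {x | ∀ i ∈ I, θ i x = 0}

/-- Pseudosphere arrangements on `S^d`. Every member is trivial or a pseudosphere, and every common
kernel `S_I` is empty, or everything, or the image of a sphere of smaller dimension on which the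
family restricts to a pseudosphere arrangement. For `1 ≤ d` the negative of a pseudosphere
is again a pseudosphere; on `S^0`, where `hom⁺` is trivial, the two orientations of the pair of
points have to be named separately. -/
def IsArrangement {ι : Type*} (d : ℕ) (θ : ι → Sph d → SignType) : Prop :=
  (∀ i, θ i = 0 ∨ IsPseudosphere (θ i) ∨ IsPseudosphere (-θ i)) ∧
  ∀ I : Set ι, commonKer θ I = ∅ ∨ commonKer θ I = univ ∨
    ∃ e : ℕ, ∃ _ : e < d, ∃ φ : Sph e ≃ₜ commonKer θ I,
      IsArrangement e (fun i x => θ i (φ x))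
termination_by d

/-- A family is spanning when the kernels of its members have no common point. -/
def IsSpanning {ι X : Type*} (θ : ι → X → SignType) : Prop := commonKer θ univ = ∅

/-- A weighted pseudosphere of rank 3: a pseudosphere with a positive weight, or the trivial one,
which has weight `0` and the zero sign map. -/
@[ext]
structure WPS where
  weight : ℝ
  aim : Sph 2 → SignType
  valid : (0 < weight ∧ IsPseudosphere aim) ∨ (weight = 0 ∧ aim = 0)

instance : Zero WPS := ⟨⟨0, 0, Or.inr ⟨rfl, rfl⟩⟩⟩

/-- The parameterizations `φ ∈ hom⁺(S²)` of a weighted pseudosphere, `aim ∘ φ = aim (e₃)`.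
For the trivial one, the weight `0` makes the parameterization irrelevant, and all are admitted. -/
def WPS.Param (α : WPS) (φ : Sph 2 ≃ₜ Sph 2) : Prop :=
  IsPos φ ∧ (α.weight ≠ 0 → α.aim ∘ φ = aimLast 2)

theorem WPS.exists_param (α : WPS) : ∃ φ, α.Param φ := by
  rcases α.valid with ⟨_, φ, h1, h2⟩ | ⟨h, _⟩
  · exact ⟨φ, h1, fun _ => h2⟩
  · exact ⟨Homeomorph.refl _, IsPos.refl, fun h' => absurd h h'⟩

/-- The supremum of `‖r₁ φ(x) - r₀ ψ(x)‖` over `x` in the equator of `S²`. -/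
def gap (r₁ r₀ : ℝ) (φ ψ : Sph 2 ≃ₜ Sph 2) : ℝ≥0∞ :=
  ⨆ x : {x : Sph 2 // aimLast 2 x = 0}, edist (r₁ • (φ x.1).1) (r₀ • (ψ x.1).1)

/-- The weighted Fréchet distance between weighted pseudospheres. -/
def wdist (α β : WPS) : ℝ≥0∞ :=
  ⨅ (φ : {φ // α.Param φ}) (ψ : {ψ // β.Param ψ}), gap α.weight β.weight φ.1 ψ.1

theorem gap_comm (r₁ r₀ : ℝ) (φ ψ : Sph 2 ≃ₜ Sph 2) : gap r₁ r₀ φ ψ = gap r₀ r₁ ψ φ := by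
  unfold gap; simp only [edist_comm]

theorem gap_triangle (a b c : ℝ) (φ ψ χ : Sph 2 ≃ₜ Sph 2) :
    gap a c φ χ ≤ gap a b φ ψ + gap b c ψ χ := by
  refine iSup_le fun x => (edist_triangle _ (b • (ψ x.1).1) _).trans (add_le_add ?_ ?_)
  · exact le_iSup (fun x : {x : Sph 2 // aimLast 2 x = 0} =>
      edist (a • (φ x.1).1) (b • (ψ x.1).1)) x
  · exact le_iSup (fun x : {x : Sph 2 // aimLast 2 x = 0} =>
      edist (b • (ψ x.1).1) (c • (χ x.1).1)) x

theorem gap_comp_le (b c : ℝ) (ψ χ h : Sph 2 ≃ₜ Sph 2) (hh : aimLast 2 ∘ h = aimLast 2) :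
    gap b c (h.trans ψ) (h.trans χ) ≤ gap b c ψ χ := by
  refine iSup_le fun x => ?_
  exact le_iSup (fun x : {x : Sph 2 // aimLast 2 x = 0} =>
      edist (b • (ψ x.1).1) (c • (χ x.1).1)) ⟨h x.1, (congrFun hh x.1).trans x.2⟩

theorem wdist_triangle (α β γ : WPS) : wdist α γ ≤ wdist α β + wdist β γ := by
  have key : ∀ (φ : {φ // α.Param φ}) (ψ : {φ // β.Param φ}) (ψ' : {φ // β.Param φ})
      (χ : {φ // γ.Param φ}), wdist α γ ≤ gap α.weight β.weight φ.1 ψ.1 +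
        gap β.weight γ.weight ψ'.1 χ.1 := by
    intro φ ψ ψ' χ
    by_cases hβ : β.weight = 0
    · refine (iInf₂_le φ χ).trans ((gap_triangle _ β.weight _ _ ψ.1 _).trans
        (add_le_add le_rfl ?_))
      simp [gap, hβ]
    · let h : Sph 2 ≃ₜ Sph 2 := ψ.1.trans ψ'.1.symm
      have hh : aimLast 2 ∘ h = aimLast 2 := by
        funext x
        have h1 := congrFun (ψ.2.2 hβ) x
        have h2 := congrFun (ψ'.2.2 hβ) (h x)
        simp only [Function.comp_apply] at h1 h2 ⊢
        rw [← h1, ← h2]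
        simp [h]
      have hχ : γ.Param (h.trans χ.1) := by
        refine ⟨(ψ.2.1.trans ψ'.2.1.symm).trans χ.2.1, fun h0 => ?_⟩
        have := χ.2.2 h0
        calc γ.aim ∘ (h.trans χ.1) = (γ.aim ∘ χ.1) ∘ h := rfl
          _ = aimLast 2 := by rw [this, hh]
      have hψ : h.trans ψ'.1 = ψ.1 := by ext x; simp [h]
      refine (iInf₂_le φ ⟨_, hχ⟩).trans ((gap_triangle _ β.weight _ _ ψ.1 _).trans
        (add_le_add le_rfl ?_))
      conv_lhs => rw [← hψ]
      exact gap_comp_le _ _ _ _ _ hh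
  unfold wdist at key ⊢
  simp only [ENNReal.iInf_add, ENNReal.add_iInf]
  exact le_iInf₂ fun φ ψ => le_iInf₂ fun ψ' χ => key _ _ _ _

instance : PseudoEMetricSpace WPS where
  edist := wdist
  edist_self α := by
    obtain ⟨φ, hφ⟩ := α.exists_param
    refine le_antisymm ((iInf₂_le ⟨φ, hφ⟩ ⟨φ, hφ⟩).trans ?_) bot_le
    simp [gap]
  edist_comm α β := by
    show wdist α β = wdist β α
    unfold wdist
    rw [iInf_comm]
    simp only [gap_comm α.weight]
  edist_triangle := wdist_triangle

/-! ### The orthogonal group and its right action -/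

/-- The orthogonal group `O(3)`, with the topology of a space of matrices. -/
abbrev O3 : Type := Matrix.orthogonalGroup (Fin 3) ℝ

/-- The special orthogonal group `SO(3)`. -/
def SO3 : Subgroup O3 where
  carrier := {Q | Q.1.det = 1}
  mul_mem' {a b} ha hb := by
    simp only [mem_ofPred_eq] at *
    simp [ha, hb]
  one_mem' := by simp
  inv_mem' {a} ha := by
    simp only [mem_ofPred_eq] at *
    have h : (a * a⁻¹).1.det = 1 := by simp
    rw [Submonoid.coe_mul, Matrix.det_mul, ha, one_mul] at h
    exact h

/-- The matrix `Q` acting on `ℝ³`. -/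
def mv (Q : O3) (x : E3) : E3 := WithLp.toLp 2 (Q.1.mulVec x.ofLp)

theorem mv_mul (P Q : O3) (x : E3) : mv (P * Q) x = mv P (mv Q x) := by
  simp [mv, Matrix.mulVec_mulVec]

theorem mv_one (x : E3) : mv 1 x = x := by simp [mv]

/-- The matrix `Q` as a linear isometry of `ℝ³`. -/
def orthLI (Q : O3) : E3 ≃ₗᵢ[ℝ] E3 where
  toFun := mv Q
  invFun := mv Q⁻¹
  left_inv x := by rw [← mv_mul, inv_mul_cancel, mv_one]
  right_inv x := by rw [← mv_mul, mul_inv_cancel, mv_one]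
  map_add' x y := by simp [mv, Matrix.mulVec_add]
  map_smul' c x := by simp [mv, Matrix.mulVec_smul]
  norm_map' x := by
    have hQ : Q.1.transpose * Q.1 = 1 := (Matrix.mem_orthogonalGroup_iff' (Fin 3) ℝ).1 Q.2
    have h : ‖mv Q x‖ ^ 2 = ‖x‖ ^ 2 := by
      rw [← real_inner_self_eq_norm_sq, ← real_inner_self_eq_norm_sq,
        EuclideanSpace.inner_eq_star_dotProduct, EuclideanSpace.inner_eq_star_dotProduct]
      simp only [mv, star_trivial]
      rw [Matrix.dotProduct_mulVec, ← Matrix.mulVec_transpose, Matrix.mulVec_mulVec, hQ,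
        Matrix.one_mulVec]
    exact (sq_eq_sq₀ (norm_nonneg _) (norm_nonneg _)).1 h

/-- A linear isometry acting on the unit sphere of `ℝ³`. -/
def sphHomeo (L : E3 ≃ₗᵢ[ℝ] E3) : Sph 2 ≃ₜ Sph 2 where
  toFun x := ⟨L x.1, by simp⟩
  invFun x := ⟨L.symm x.1, by simp⟩
  left_inv x := by simp
  right_inv x := by simp
  continuous_toFun := by fun_prop
  continuous_invFun := by fun_prop

/-- `O(3)` as a set of homeomorphisms of `S²`. -/
def orthHomeo (Q : O3) : Sph 2 ≃ₜ Sph 2 := sphHomeo (orthLI Q)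

theorem orthHomeo_one (x : Sph 2) : orthHomeo 1 x = x := Subtype.ext (mv_one x.1)

theorem orthHomeo_mul (P Q : O3) (x : Sph 2) :
    orthHomeo (P * Q) x = orthHomeo P (orthHomeo Q x) := Subtype.ext (mv_mul P Q x.1)

/-- The reflection of `S²` in the plane orthogonal to `v`. -/
def reflHomeo (v : E3) : Sph 2 ≃ₜ Sph 2 := sphHomeo (Submodule.reflection (Submodule.span ℝ {v})ᗮ)

theorem reflHomeo_coe (v : Sph 2) (x : Sph 2) :
    (reflHomeo v.1 x).1 = x.1 - (2 * inner ℝ v.1 x.1) • v.1 := by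
  have hv : ‖v.1‖ = 1 := by simp
  show Submodule.reflection (Submodule.span ℝ {v.1})ᗮ x.1 = _
  rw [Submodule.reflection_orthogonal_apply, Submodule.reflection_singleton_apply, hv]
  simp [two_mul, add_smul, two_smul]

theorem reflHomeo_reflHomeo (v : E3) (x : Sph 2) : reflHomeo v (reflHomeo v x) = x :=
  Subtype.ext (Submodule.reflection_reflection _ _)

theorem isPos_refl_refl (v w : Sph 2) : IsPos ((reflHomeo w.1).trans (reflHomeo v.1)) := by
  let f : C(Sph 2 × Sph 2, Sph 2) :=
    ⟨fun p => reflHomeo p.1.1 (reflHomeo w.1 p.2), by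
      refine Continuous.subtype_mk (f := fun p : Sph 2 × Sph 2 =>
        (reflHomeo p.1.1 (reflHomeo w.1 p.2)).1) ?_ _
      simp only [reflHomeo_coe]
      fun_prop⟩
  have hconn : IsPreconnected (univ : Set (Sph 2)) := by
    have h : IsPreconnected (Metric.sphere (0 : E3) 1) :=
      isPreconnected_sphere (by simp [E3, ← Module.finrank_eq_rank]) _ _
    exact (Subtype.preconnectedSpace h).isPreconnected_univ
  have hsub : f.curry '' univ ⊆
      connectedComponentIn {g : C(Sph 2, Sph 2) | IsHomeomorph g} (ContinuousMap.id _) := by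
    refine (hconn.image _ f.curry.continuous.continuousOn).subset_connectedComponentIn
      ⟨w, trivial, ?_⟩ ?_
    · ext1 x; exact reflHomeo_reflHomeo _ _
    · rintro _ ⟨u, -, rfl⟩
      exact ((reflHomeo w.1).trans (reflHomeo u.1)).isHomeomorph
  exact hsub ⟨v, trivial, rfl⟩

theorem IsPseudosphere.comp_refl {θ : Sph 2 → SignType} (hθ : IsPseudosphere θ) (v : E3) :
    IsPseudosphere (θ ∘ reflHomeo v) := by
  by_cases hv : v = 0
  · have : (reflHomeo v : Sph 2 → Sph 2) = id := by
      funext x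
      refine Subtype.ext ?_
      show Submodule.reflection (Submodule.span ℝ {v})ᗮ x.1 = x.1
      exact (Submodule.reflection_eq_self_iff x.1).2 (by simp [hv])
    rwa [this]
  · let u : Sph 2 := ⟨‖v‖⁻¹ • v, by simp [norm_smul, hv]⟩
    have hu : reflHomeo v = reflHomeo u.1 := by
      have : Submodule.span ℝ {u.1} = Submodule.span ℝ {v} :=
        Submodule.span_singleton_smul_eq (IsUnit.mk0 _ (by simp [hv])) v
      unfold reflHomeo
      simp only [this]
    let w : Sph 2 := ⟨EuclideanSpace.single 0 1, by simp⟩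
    obtain ⟨φ, hφ, h⟩ := hθ
    refine ⟨((reflHomeo w.1).trans φ).trans (reflHomeo v), ?_, ?_⟩
    · rw [hu]
      exact hφ.sandwich _ _ (isPos_refl_refl u w)
    · funext x
      have h1 := congrFun h (reflHomeo w.1 x)
      simp only [Function.comp_apply, Homeomorph.trans_apply, reflHomeo_reflHomeo] at h1 ⊢
      rw [h1, aimLast, aimLast, reflHomeo_coe]
      congr 1
      simp [w]

theorem IsPseudosphere.comp_orth {θ : Sph 2 → SignType} (hθ : IsPseudosphere θ) (Q : O3) :
    IsPseudosphere (θ ∘ orthHomeo Q) := by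
  obtain ⟨l, -, hl⟩ := (orthLI Q).reflections_generate_dim
  unfold orthHomeo
  rw [hl]
  clear hl
  induction l generalizing θ with
  | nil => exact hθ
  | cons v l ih => exact ih (hθ.comp_refl v)

theorem IsArrangement.comp_homeo {ι : Type*} {d : ℕ} {θ : ι → Sph d → SignType}
    (hθ : IsArrangement d θ) (h : Sph d ≃ₜ Sph d)
    (hh : ∀ i, θ i ∘ h = 0 ∨ IsPseudosphere (θ i ∘ h) ∨ IsPseudosphere (-(θ i ∘ h))) :
    IsArrangement d (fun i => θ i ∘ h) := by
  rw [IsArrangement] at hθ ⊢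
  refine ⟨hh, fun I => ?_⟩
  have hk : commonKer (fun i => θ i ∘ h) I = h ⁻¹' commonKer θ I := rfl
  rcases hθ.2 I with h0 | h0 | ⟨e, he, φ, hφ⟩
  · left; rw [hk, h0, preimage_empty]
  · right; left; rw [hk, h0, preimage_univ]
  · right; right
    let g : commonKer (fun i => θ i ∘ h) I ≃ₜ commonKer θ I := h.sets rfl
    refine ⟨e, he, φ.trans g.symm, ?_⟩
    convert hφ using 3 with i x
    have : g (g.symm (φ x)) = φ x := g.apply_symm_apply _
    exact congrArg (θ i) (congrArg Subtype.val this)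

/-- A family each of whose members is trivial or a member of an arrangement is an arrangement. -/
theorem IsArrangement.of_subfamily {ι κ : Type*} {d : ℕ} {θ : ι → Sph d → SignType}
    (hθ : IsArrangement d θ) (η : κ → Sph d → SignType) (hη : ∀ j, η j = 0 ∨ ∃ i, η j = θ i) :
    IsArrangement d η := by
  induction d using Nat.strong_induction_on with
  | _ d ih =>
    rw [IsArrangement] at hθ ⊢
    refine ⟨fun j => ?_, fun I => ?_⟩
    · rcases hη j with h | ⟨i, h⟩
      · exact Or.inl h
      · rw [h]; exact hθ.1 i
    · have hk : commonKer η I = commonKer θ {i | ∃ j ∈ I, η j = θ i} := by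
        ext x
        constructor
        · rintro hx i ⟨j, hj, hji⟩
          rw [← hji]; exact hx j hj
        · intro hx j hj
          rcases hη j with h | ⟨i, h⟩
          · rw [h]; rfl
          · rw [h]; exact hx i ⟨j, hj, h⟩
      rw [hk]
      rcases hθ.2 {i | ∃ j ∈ I, η j = θ i} with h | h | ⟨e, he, φ, hφ⟩
      · exact Or.inl h
      · exact Or.inr (Or.inl h)
      · refine Or.inr (Or.inr ⟨e, he, φ, ih e he hφ _ fun j => ?_⟩)
        rcases hη j with h | ⟨i, h⟩
        · left; rw [h]; rfl
        · right; exact ⟨i, by rw [h]⟩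

/-- The right action `α * Q = (r, θ ∘ Q)` of `O(3)` on weighted pseudospheres. -/
instance : MulAction O3ᵐᵒᵖ WPS where
  smul Q α := ⟨α.weight, α.aim ∘ orthHomeo Q.unop, by
    rcases α.valid with ⟨h1, h2⟩ | ⟨h1, h2⟩
    · exact Or.inl ⟨h1, h2.comp_orth _⟩
    · exact Or.inr ⟨h1, by rw [h2]; rfl⟩⟩
  one_smul α := WPS.ext rfl (funext fun x => congrArg α.aim (orthHomeo_one x))
  mul_smul P Q α := WPS.ext rfl (funext fun x => congrArg α.aim (orthHomeo_mul Q.unop P.unop x))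

/-- The right action `x * Q = Q^* x` of `O(3)` on `ℝ³`. -/
instance : MulAction O3ᵐᵒᵖ E3 where
  smul Q x := mv Q.unop⁻¹ x
  one_smul x := by
    show mv (1 : O3)⁻¹ x = x
    rw [inv_one, mv_one]
  mul_smul P Q x := by
    show mv (Q.unop * P.unop)⁻¹ x = mv P.unop⁻¹ (mv Q.unop⁻¹ x)
    rw [mul_inv_rev, mv_mul]

/-- Shortcut instances for the restriction of the actions to `SO(3)`. -/
instance : MulAction SO3.op E3 := Subgroup.instMulAction

instance (X : Type*) [MulAction O3ᵐᵒᵖ X] : MulAction SO3.op (X × E3) := Prod.mulAction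

instance (X : Type*) [MulAction O3ᵐᵒᵖ X] : SMul SO3.op (X × E3) := SemigroupAction.toSMul

/-! ### Pseudolinear Stiefel manifolds -/

/-- `A` is a spanning weighted pseudosphere arrangement of rank 3. -/
def IsSpanningArr {ι : Type*} (A : ι → WPS) : Prop :=
  IsArrangement 2 (fun i => (A i).aim) ∧ IsSpanning (fun i => (A i).aim)

theorem IsSpanningArr.smul {ι : Type*} {A : ι → WPS} (hA : IsSpanningArr A) (Q : O3ᵐᵒᵖ) :
    IsSpanningArr (Q • A) := by
  refine ⟨hA.1.comp_homeo (orthHomeo Q.unop) fun i => ?_, ?_⟩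
  · rcases (A i).valid with ⟨-, h⟩ | ⟨-, h⟩
    · exact Or.inr (Or.inl (h.comp_orth _))
    · left; rw [h]; rfl
  · show orthHomeo Q.unop ⁻¹' commonKer (fun i => (A i).aim) univ = ∅
    rw [show commonKer (fun i => (A i).aim) univ = ∅ from hA.2, preimage_empty]

/-- The pseudolinear Stiefel manifold of rank 3 on `n` elements. As a subspace of the finite product
`Fin n → WPS` it has the topology of the maximum of the distances of the entries. -/
def PStief (n : ℕ) : Type := {A : Fin n → WPS // IsSpanningArr A}

instance (n : ℕ) : TopologicalSpace (PStief n) :=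
  inferInstanceAs (TopologicalSpace {A : Fin n → WPS // IsSpanningArr A})

instance (n : ℕ) : MulAction O3ᵐᵒᵖ (PStief n) where
  smul Q A := ⟨Q • A.1, A.2.smul Q⟩
  one_smul A := Subtype.ext (one_smul _ A.1)
  mul_smul P Q A := Subtype.ext (mul_smul P Q A.1)

/-- The infinite pseudolinear Stiefel manifold of rank 3: sequences that end in a tail of zeros. -/
def PStiefInf : Type := {A : ℕ → WPS // (∃ n, ∀ i ≥ n, A i = 0) ∧ IsSpanningArr A}

/-- Extension of a finite arrangement by a tail of zeros. -/
def PStief.extend {n : ℕ} (A : PStief n) : PStiefInf :=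
  ⟨fun i => if h : i < n then A.1 ⟨i, h⟩ else 0,
    ⟨n, fun i hi => dif_neg (not_lt.2 hi)⟩, by
    constructor
    · refine A.2.1.of_subfamily _ fun i => ?_
      by_cases h : i < n
      · right; exact ⟨⟨i, h⟩, by simp only [dif_pos h]⟩
      · left; simp only [dif_neg h]; rfl
    · refine eq_empty_of_subset_empty fun x hx => ?_
      have : x ∈ commonKer (fun i => (A.1 i).aim) univ := by
        intro i _
        have := hx i.1 trivial
        simpa only [dif_pos i.2] using this
      rw [show commonKer (fun i => (A.1 i).aim) univ = ∅ from A.2.2] at this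
      exact this⟩

/-- The direct limit topology: the finest one for which the inclusions of the finite pseudolinear
Stiefel manifolds are continuous. -/
instance : TopologicalSpace PStiefInf :=
  ⨆ n : ℕ, TopologicalSpace.coinduced (PStief.extend (n := n)) inferInstance

instance : MulAction O3ᵐᵒᵖ PStiefInf where
  smul Q A := ⟨Q • A.1, by
    obtain ⟨n, hn⟩ := A.2.1
    exact ⟨n, fun i hi => by rw [Pi.smul_apply, hn i hi]; rfl⟩, A.2.2.smul Q⟩
  one_smul A := Subtype.ext (one_smul _ A.1)
  mul_smul P Q A := Subtype.ext (mul_smul P Q A.1)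

/-! ### Grassmannians and canonical bundles -/

section Quotients
variable (X : Type*) [TopologicalSpace X] [MulAction O3ᵐᵒᵖ X]

/-- The quotient of a right `O(3)`-space by `O(3)`, with the quotient topology. For a pseudolinear
Stiefel manifold this is the pseudolinear Grassmannian. -/
abbrev PGr : Type _ := Quotient (MulAction.orbitRel O3ᵐᵒᵖ X)

/-- The quotient by `SO(3)`: the oriented pseudolinear Grassmannian. -/
abbrev POGr : Type _ := Quotient (MulAction.orbitRel SO3.op X)

/-- The canonical bundle `(X × ℝ³) / O(3)`, where `Q` takes `(A, x)` to `(A * Q, Q^* x)`. -/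
abbrev PE : Type _ := Quotient (MulAction.orbitRel O3ᵐᵒᵖ (X × E3))

/-- The oriented canonical bundle `(X × ℝ³) / SO(3)`. -/
abbrev POE : Type _ := Quotient (MulAction.orbitRel SO3.op (X × E3))

/-- The projection `ξ` induced by `(A, x) ↦ A`. -/
def xi : PE X → PGr X := Quotient.map Prod.fst (by
  rintro _ _ ⟨Q, rfl⟩
  exact ⟨Q, rfl⟩)

/-- The projection of the oriented canonical bundle, induced by `(A, x) ↦ A`. -/
def xiOr : POE X → POGr X := Quotient.map Prod.fst (by
  rintro _ _ ⟨Q, rfl⟩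
  exact ⟨Q, rfl⟩)

variable {X}

/-- The point of the fibre of `ξ` over the class of `A` that is represented by `(A, x)`. -/
def xiPt (A : X) (x : E3) : xi X ⁻¹' {(Quotient.mk _ A : PGr X)} := ⟨Quotient.mk _ (A, x), rfl⟩

/-- The point of the fibre of the oriented bundle over the class of `A` represented by `(A, x)`. -/
def xiOrPt (A : X) (x : E3) : xiOr X ⁻¹' {(Quotient.mk _ A : POGr X)} :=
  ⟨Quotient.mk _ (A, x), rfl⟩

end Quotients

/-! ### Principal bundles and vector bundles -/

/-- The right `G`-space `X` is a locally trivial principal `G`-bundle over `X / G`: the action is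
continuous and free, the translation function is continuous, and over a neighborhood of every point
of `X / G` there is a `G`-equivariant trivialization. -/
structure IsLocTrivPrincipalBundle (G X : Type*) [Group G] [TopologicalSpace G]
    [TopologicalSpace X] [MulAction Gᵐᵒᵖ X] : Prop where
  continuous_action : Continuous fun p : X × G => op p.2 • p.1
  free : ∀ (x : X) (g : G), op g • x = x → g = 1
  translation : ∃ τ : {p : X × X // ∃ g : G, op g • p.1 = p.2} → G,
    Continuous τ ∧ ∀ p, op (τ p) • p.1.1 = p.1.2
  locally_trivial : ∀ b : Quotient (MulAction.orbitRel Gᵐᵒᵖ X),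
    ∃ e : Bundle.Trivialization G (Quotient.mk (MulAction.orbitRel Gᵐᵒᵖ X)),
      b ∈ e.baseSet ∧
      ∀ x : X, Quotient.mk (MulAction.orbitRel Gᵐᵒᵖ X) x ∈ e.baseSet →
        ∀ g : G, (e (op g • x)).2 = (e x).2 * g

/-- The structure of a real vector bundle of rank 3 on `p : E → B`: a vector space structure on
every fibre such that near every point of `B` there is a local trivialization which is a linear
isomorphism on every fibre. -/
structure VectorBundleStr {E B : Type*} [TopologicalSpace E] [TopologicalSpace B]
    (p : E → B) where
  addCommGroup : ∀ b, AddCommGroup (p ⁻¹' {b})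
  module : ∀ b, Module ℝ (p ⁻¹' {b})
  locally_trivial : ∀ b, ∃ e : Bundle.Trivialization E3 p, b ∈ e.baseSet ∧
    ∀ b' ∈ e.baseSet, ∃ L : (p ⁻¹' {b'}) ≃ₗ[ℝ] E3, ∀ v, L v = (e v.1).2

/-- The standard orientation of `ℝ³`. -/
def stdOr : Orientation ℝ E3 (Fin 3) := (EuclideanSpace.basisFun (Fin 3) ℝ).toBasis.orientation

/-- The structure of an oriented real vector bundle of rank 3: moreover every fibre has an
orientation, and the local trivializations can be chosen to preserve orientations. -/
structure OrientedVectorBundleStr {E B : Type*} [TopologicalSpace E] [TopologicalSpace B]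
    (p : E → B) extends VectorBundleStr p where
  orientation : ∀ b, Orientation ℝ (p ⁻¹' {b}) (Fin 3)
  locally_oriented : ∀ b, ∃ e : Bundle.Trivialization E3 p, b ∈ e.baseSet ∧
    ∀ b' ∈ e.baseSet, ∃ L : (p ⁻¹' {b'}) ≃ₗ[ℝ] E3, (∀ v, L v = (e v.1).2) ∧
      Orientation.map (Fin 3) L (orientation b') = stdOr

/-- `ξ` is a vector bundle, with the fibrewise linear structure coming from `ℝ³`: for every `A`,
the map `x ↦ [A, x]` is a linear isomorphism from `ℝ³` to the fibre over the class of `A`. -/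
def XiIsVectorBundle (X : Type*) [TopologicalSpace X] [MulAction O3ᵐᵒᵖ X] : Prop :=
  ∃ S : VectorBundleStr (xi X), ∀ A : X,
    letI := S.addCommGroup; letI := S.module
    ∃ L : E3 ≃ₗ[ℝ] (xi X ⁻¹' {(Quotient.mk _ A : PGr X)}), ∀ x, L x = xiPt A x

/-- The oriented canonical projection is an oriented vector bundle, with the fibrewise linear
structure and orientation coming from `ℝ³`. -/
def XiOrIsOrientedVectorBundle (X : Type*) [TopologicalSpace X] [MulAction O3ᵐᵒᵖ X] : Prop :=
  ∃ S : OrientedVectorBundleStr (xiOr X), ∀ A : X,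
    letI := S.addCommGroup; letI := S.module
    ∃ L : E3 ≃ₗ[ℝ] (xiOr X ⁻¹' {(Quotient.mk _ A : POGr X)}), (∀ x, L x = xiOrPt A x) ∧
      Orientation.map (Fin 3) L stdOr = S.orientation (Quotient.mk _ A)

end Pseudo

end

open Pseudo

/-! The bundles exist because orthonormal frames can be attached continuously and equivariantly to
all arrangements near a given one. Such a local frame (`HasLocalFrame`) is a continuous map `u` to
O(3) on an invariant open set with u(A * Q) = u(A) Q. It forces trivial stabilizers, gives the
translation function locally as u(A)⁻¹ u(B), and yields the charts A ↦ ([A], u(A)) of the principal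
bundle and [A, x] ↦ ([A], u(A) x) of the vector bundle. For the oriented bundle, `u` is normalized
to determinant 1.

Frames come from averaging (`hasLocalFrame_of_edist`). For a bump function h about y, the matrix
M(z) = ∫ h(z * Q) Q dQ over Haar measure satisfies M(z * P) = P⁻¹ M(z). If h vanishes at y * Q
unless Q is close to 1, then M(y) is invertible, and so is M(z) for z in an invariant neighborhood.
Gram-Schmidt commutes with left multiplication by orthogonal matrices, so the inverse of the
orthonormalized M(z) is a frame. The only input is a continuous action on a pseudometric space for
which y * Q is at positive distance from y whenever Q ≠ 1.

Three members of a spanning arrangement suffice for this (`exists_flag`,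
`IsSpanningArr.exists_triple`). A common symmetry maps the circle that is the kernel of the first
member to itself, preserves the two arcs cut out by the second, and fixes their endpoints, which the
third tells apart. On an arc it is an increasing map conjugate to an isometric one, hence the
identity (`circle_symmetry_trivial`); an orthogonal symmetry of a pseudosphere that fixes the kernel
pointwise is trivial (`IsPseudosphere.orth_eq_one`). Frames are pulled back from the space of
triples, so finite n and n = ∞ are treated alike and no metric on the direct limit is needed.

Finally, distance zero must mean equality (`WPS.eq_of_edist_eq_zero`). It forces equal weights and
equal kernels, so the sign maps agree or are opposite. Opposite ones are excluded by winding
numbers: a parameterization in hom⁺ carries the equator once positively around any chord from the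
positive to the negative side. -/

noncomputable section

namespace Pseudo

/-! ### Winding classes of loops in the punctured plane -/

/-- Two functions to the punctured plane have the same winding when their quotient has a continuous
logarithm. -/
def SameWinding {E : Type*} [TopologicalSpace E] (γ δ : E → ℂ) : Prop :=
  ∃ g : E → ℂ, Continuous g ∧ ∀ x, γ x = δ x * Complex.exp (g x)

section SameWinding
variable {E : Type*} [TopologicalSpace E] {γ δ ε : E → ℂ}

theorem SameWinding.symm (h : SameWinding γ δ) : SameWinding δ γ := by
  obtain ⟨g, hg, h⟩ := h
  refine ⟨-g, hg.neg, fun x => ?_⟩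
  rw [h x, mul_assoc, ← Complex.exp_add]
  simp

theorem SameWinding.trans (h : SameWinding γ δ) (h' : SameWinding δ ε) : SameWinding γ ε := by
  obtain ⟨g, hg, h⟩ := h
  obtain ⟨g', hg', h'⟩ := h'
  refine ⟨g' + g, hg'.add hg, fun x => ?_⟩
  rw [h x, h' x, mul_assoc, ← Complex.exp_add]
  rfl

theorem SameWinding.conj (h : SameWinding γ δ) :
    SameWinding (fun x => starRingEnd ℂ (γ x)) (fun x => starRingEnd ℂ (δ x)) := by
  obtain ⟨g, hg, h⟩ := h
  refine ⟨fun x => starRingEnd ℂ (g x), Complex.continuous_conj.comp hg, fun x => ?_⟩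
  simp only [h x, map_mul, Complex.exp_conj]

/-- The quotient γ / δ stays within distance less than 1 of 1, where the principal logarithm is
continuous. -/
theorem SameWinding.of_norm_sub_lt (hγ : Continuous γ) (hδ : Continuous δ)
    (h : ∀ x, ‖γ x - δ x‖ < ‖δ x‖) : SameWinding γ δ := by
  have h0 : ∀ x, δ x ≠ 0 := fun x => norm_pos_iff.1 ((norm_nonneg _).trans_lt (h x))
  have hs : ∀ x, γ x / δ x ∈ Complex.slitPlane := by
    intro x
    refine Complex.mem_slitPlane_of_norm_lt_one (z := γ x / δ x - 1) ?_ |> fun h => by simpa using h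
    rw [div_sub_one (h0 x), norm_div, div_lt_one (norm_pos_iff.2 (h0 x))]
    exact h x
  refine ⟨fun x => Complex.log (γ x / δ x), (hγ.div hδ h0).clog hs, fun x => ?_⟩
  rw [Complex.exp_log (Complex.slitPlane_ne_zero (hs x)), mul_div_cancel₀ _ (h0 x)]

/-- The winding is constant in a connected family of functions to the punctured plane. -/
theorem SameWinding.of_connected {T : Type*} [TopologicalSpace T] [PreconnectedSpace T]
    [CompactSpace E] {G : T → E → ℂ} (hG : Continuous (Function.uncurry G))
    (h0 : ∀ t x, G t x ≠ 0) (s t : T) : SameWinding (G s) (G t) := by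
  have hGt : ∀ t, Continuous (G t) := fun t => hG.comp (Continuous.prodMk_right t)
  -- Having the same winding is an equivalence relation, so on a connected parameter space it is
  -- enough that nearby parameters are related; compactness of `E` makes the estimate uniform in
  -- `x`.
  have : Std.Symm (fun s t => SameWinding (G s) (G t)) := ⟨fun _ _ h => h.symm⟩
  refine PreconnectedSpace.induction₂ (fun s t => SameWinding (G s) (G t)) (fun s => ?_)
    ⟨fun _ _ _ h h' => h.trans h'⟩ s t
  have key : ∀ᶠ t in 𝓝 s, ∀ x ∈ (univ : Set E), ‖G t x - G s x‖ < ‖G s x‖ := by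
    refine isCompact_univ.eventually_forall_of_forall_eventually fun x _ => ?_
    have hc : Continuous fun p : T × E => ‖G p.1 p.2 - G s p.2‖ :=
      (hG.sub ((hGt s).comp continuous_snd)).norm
    have hc' : Continuous fun p : T × E => ‖G s p.2‖ := ((hGt s).comp continuous_snd).norm
    refine hc.continuousAt.eventually_lt hc'.continuousAt ?_
    simpa using h0 s x
  filter_upwards [key] with t ht
  exact (SameWinding.of_norm_sub_lt (hGt t) (hGt s) fun x => ht x trivial).symm

end SameWinding

/-! ### The angle of a point of the sphere about a chord -/

/-- The complex number whose argument is the angle about the chord from `a` to `b` that takes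
the half plane of `p` to the half plane of `x`. -/
def chordAngle (a b p x : E3) : ℂ :=
  ⟨‖a - b‖ ^ 2 * inner ℝ (x - a) (p - a) - inner ℝ (x - a) (a - b) * inner ℝ (p - a) (a - b),
    ‖a - b‖ * ((a - b) 0 * ((p - a) 1 * (x - a) 2 - (p - a) 2 * (x - a) 1)
      + (a - b) 1 * ((p - a) 2 * (x - a) 0 - (p - a) 0 * (x - a) 2)
      + (a - b) 2 * ((p - a) 0 * (x - a) 1 - (p - a) 1 * (x - a) 0))⟩

theorem inner_E3 (x y : E3) : inner ℝ x y = x 0 * y 0 + x 1 * y 1 + x 2 * y 2 := by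
  simp [PiLp.inner_apply, Fin.sum_univ_three, mul_comm]

theorem norm_sq_E3 (x : E3) : ‖x‖ ^ 2 = x 0 ^ 2 + x 1 ^ 2 + x 2 ^ 2 := by
  rw [← real_inner_self_eq_norm_sq, inner_E3]; ring

theorem continuous_chordAngle :
    Continuous fun q : E3 × E3 × E3 × E3 => chordAngle q.1 q.2.1 q.2.2.1 q.2.2.2 := by
  refine Complex.equivRealProdCLM.symm.continuous.comp (f := fun q : E3 × E3 × E3 × E3 =>
    ((chordAngle q.1 q.2.1 q.2.2.1 q.2.2.2).re, (chordAngle q.1 q.2.1 q.2.2.1 q.2.2.2).im)) ?_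
  unfold chordAngle
  fun_prop

/-- Reversing the chord reverses the sense of rotation. This is how the orientation of a
pseudosphere enters the winding. -/
theorem chordAngle_swap (a b p x : E3) :
    chordAngle b a p x = starRingEnd ℂ (chordAngle a b p x) := by
  apply Complex.ext
  · simp only [chordAngle, Complex.conj_re, norm_sq_E3, inner_E3, PiLp.sub_apply]
    ring
  · simp only [chordAngle, Complex.conj_im, PiLp.sub_apply, norm_sub_rev b a]
    ring

/-- A line meets the sphere in at most two points. -/
theorem chord_gram_ne_zero {a b x : E3} (ha : ‖a‖ = 1) (hb : ‖b‖ = 1) (hx : ‖x‖ = 1)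
    (hab : a ≠ b) (hxa : x ≠ a) (hxb : x ≠ b) :
    ‖a - b‖ ^ 2 * ‖x - a‖ ^ 2 - inner ℝ (x - a) (a - b) ^ 2 ≠ 0 := by
  intro h
  have hd : 0 < ‖a - b‖ ^ 2 := by
    have := norm_pos_iff.2 (sub_ne_zero.2 hab); positivity
  have hz : 0 < ‖x - a‖ ^ 2 := by
    have := norm_pos_iff.2 (sub_ne_zero.2 hxa); positivity
  have hy : 0 < ‖x - b‖ ^ 2 := by
    have := norm_pos_iff.2 (sub_ne_zero.2 hxb); positivity
  have ha' : ‖a‖ ^ 2 = 1 := by rw [ha]; norm_num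
  have hb' : ‖b‖ ^ 2 = 1 := by rw [hb]; norm_num
  have hx' : ‖x‖ ^ 2 = 1 := by rw [hx]; norm_num
  have e1 := norm_sub_sq_real a b
  have e2 := norm_sub_sq_real x a
  have e3 := norm_sub_sq_real x b
  have e4 : inner ℝ (x - a) (a - b) = inner ℝ x a - inner ℝ x b - 1 + inner ℝ a b := by
    rw [inner_sub_left, inner_sub_right, inner_sub_right, real_inner_self_eq_norm_sq, ha']; ring
  rw [e4, e1, e2, ha', hb', hx'] at h
  rw [e1, ha', hb'] at hd
  rw [e2, ha', hx'] at hz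
  rw [e3, hx', hb'] at hy
  -- Equality in Cauchy-Schwarz: this squared norm is ‖a - b‖² times the Gram determinant, so x lies
  -- on the line through a and b.
  have hw : ‖(‖a - b‖ ^ 2) • (x - a) - (inner ℝ (x - a) (a - b) : ℝ) • (a - b)‖ ^ 2 = 0 := by
    rw [norm_sub_sq_real, norm_smul, norm_smul, inner_smul_left, inner_smul_right]
    simp only [Real.norm_eq_abs, mul_pow, sq_abs, conj_trivial, e4, e1, e2, ha', hb', hx']
    linear_combination (1 - 2 * inner ℝ a b + 1) * h
  have hw' : (‖a - b‖ ^ 2) • (x - a) = (inner ℝ (x - a) (a - b) : ℝ) • (a - b) :=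
    sub_eq_zero.1 (norm_eq_zero.1 (pow_eq_zero_iff two_ne_zero |>.1 hw))
  have h1 := congrArg (fun v => inner ℝ v a) hw'
  simp only [inner_smul_left, inner_sub_left, conj_trivial, e1, ha', hb', e4,
    real_inner_self_eq_norm_sq, real_inner_comm a b] at h1
  have h2 : 2 * (inner ℝ x a - 1) = inner ℝ x a - inner ℝ x b - 1 + inner ℝ a b :=
    mul_left_cancel₀ (show 1 - inner ℝ a b ≠ 0 by linarith) (by linear_combination h1)
  -- The chords from a to b and from a to x have equal length; together with `h2` this gives ⟨x, b⟩
  -- = 1, which contradicts x ≠ b.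
  have h3 : 2 - 2 * inner ℝ a b = 2 - 2 * inner ℝ x a := by
    refine mul_left_cancel₀ hz.ne' ?_
    rw [← h2] at h
    linear_combination h
  linarith

theorem chordAngle_ne_zero {a b p x : E3} (ha : ‖a‖ = 1) (hb : ‖b‖ = 1) (hp : ‖p‖ = 1)
    (hx : ‖x‖ = 1) (hab : a ≠ b) (hpa : p ≠ a) (hpb : p ≠ b) (hxa : x ≠ a) (hxb : x ≠ b) :
    chordAngle a b p x ≠ 0 := by
  intro h
  have h1 := congrArg Complex.re h
  have h2 := congrArg Complex.im h
  -- Up to scaling, the real and imaginary parts are the inner product and the oriented area of the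
  -- projections of p - a and x - a along the chord; their squares add up to the product of the two
  -- squared lengths.
  have key : (chordAngle a b p x).re ^ 2 + (chordAngle a b p x).im ^ 2 =
      (‖a - b‖ ^ 2 * ‖x - a‖ ^ 2 - inner ℝ (x - a) (a - b) ^ 2) *
      (‖a - b‖ ^ 2 * ‖p - a‖ ^ 2 - inner ℝ (p - a) (a - b) ^ 2) := by
    simp only [chordAngle, mul_pow, norm_sq_E3, inner_E3]
    ring
  rw [h1, h2] at key
  refine mul_ne_zero (chord_gram_ne_zero ha hb hx hab hxa hxb)
    (chord_gram_ne_zero ha hb hp hab hpa hpb) ?_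
  rw [← key]; simp

/-! ### Hemispheres and the equator -/

/-- The equator of `S²`. -/
abbrev Equator : Type := {x : Sph 2 // aimLast 2 x = 0}

/-- The point of `S²` on a coordinate axis. -/
def axis (i : Fin 3) : Sph 2 := ⟨EuclideanSpace.single i 1, by simp⟩

theorem axis_apply (i j : Fin 3) : (axis i).1 j = if j = i then 1 else 0 := by
  simp [axis]

theorem aimLast_eq_zero_iff {x : Sph 2} : aimLast 2 x = 0 ↔ x.1 2 = 0 := sign_eq_zero_iff

theorem aimLast_eq_one_iff {x : Sph 2} : aimLast 2 x = 1 ↔ 0 < x.1 2 := sign_eq_one_iff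

theorem aimLast_eq_neg_one_iff {x : Sph 2} : aimLast 2 x = -1 ↔ x.1 2 < 0 := sign_eq_neg_one_iff

theorem continuous_sph_apply (i : Fin 3) : Continuous fun x : Sph 2 => x.1 i := by fun_prop

instance : CompactSpace (Sph 2) := Metric.sphere.compactSpace _ _

instance : CompactSpace Equator := by
  refine isCompact_iff_compactSpace.1 (IsClosed.isCompact ?_)
  simp only [aimLast_eq_zero_iff]
  exact isClosed_eq (continuous_sph_apply 2) continuous_const

/-- The point of the equator on the first coordinate axis. -/
def east : Equator := ⟨axis 0, aimLast_eq_zero_iff.2 (by simp [axis_apply])⟩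

/-- An open hemisphere is the radial projection of an open half space, which is convex. -/
theorem isPreconnected_hemisphere (n : E3) : IsPreconnected {x : Sph 2 | 0 < inner ℝ n x.1} := by
  rw [← Topology.IsInducing.subtypeVal.isPreconnected_image]
  have h : Subtype.val '' {x : Sph 2 | 0 < inner ℝ n x.1} =
      (fun v : E3 => ‖v‖⁻¹ • v) '' {v | 0 < inner ℝ n v} := by
    ext y
    constructor
    · rintro ⟨x, hx, rfl⟩
      exact ⟨x.1, hx, by simp⟩
    · rintro ⟨v, hv, rfl⟩
      have hv0 : v ≠ 0 := by rintro rfl; simp at hv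
      refine ⟨⟨‖v‖⁻¹ • v, by simp [norm_smul, hv0]⟩, ?_, rfl⟩
      have : 0 < ‖v‖⁻¹ := inv_pos.2 (norm_pos_iff.2 hv0)
      simp only [mem_ofPred_eq, inner_smul_right] at hv ⊢
      positivity
  rw [h]
  have hconv : Convex ℝ {v : E3 | 0 < inner ℝ n v} :=
    convex_halfSpace_gt (f := fun v : E3 => (inner ℝ n v : ℝ))
      ⟨fun x y => inner_add_right _ _ _, fun c x => inner_smul_right _ _ _⟩ 0
  refine hconv.isPreconnected.image _ (ContinuousOn.fun_smul
    (ContinuousOn.inv₀ continuous_norm.continuousOn ?_) continuousOn_id)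
  · intro v hv h0
    rw [norm_eq_zero.1 h0] at hv
    simp at hv

theorem isPreconnected_aimLast_eq_one : IsPreconnected {x : Sph 2 | aimLast 2 x = 1} := by
  convert isPreconnected_hemisphere (axis 2).1 using 3 with x
  rw [aimLast_eq_one_iff, inner_E3]
  simp [axis_apply]

theorem isPreconnected_aimLast_eq_neg_one : IsPreconnected {x : Sph 2 | aimLast 2 x = -1} := by
  convert isPreconnected_hemisphere (-(axis 2).1) using 3 with x
  rw [aimLast_eq_neg_one_iff, inner_E3]
  simp [axis_apply]

/-! ### The orientation of the parameterizations of a pseudosphere -/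

/-- The equator as the unit circle of the complex plane. -/
def equatorCoord (x : Equator) : ℂ := ⟨x.1.1 0, x.1.1 1⟩

/-- The winding numbers are -1 and 1. Along exp(it) a logarithm g of the quotient would make Im g +
2t a continuous function with values in 2πℤ, hence constant, yet it grows by 4π over one period. -/
theorem not_sameWinding_conj_equatorCoord :
    ¬ SameWinding (fun x => starRingEnd ℂ (equatorCoord x)) equatorCoord := by
  rintro ⟨g, hg, h⟩
  let c : ℝ → Equator := fun t => ⟨⟨!₂[Real.cos t, Real.sin t, 0], by
    simp [EuclideanSpace.norm_eq, Fin.sum_univ_three]⟩, aimLast_eq_zero_iff.2 (by simp)⟩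
  have hc : Continuous c := by
    refine Continuous.subtype_mk (Continuous.subtype_mk ?_ _) _
    refine (PiLp.continuous_toLp 2 _).comp (continuous_pi fun i => ?_)
    fin_cases i
    · exact Real.continuous_cos
    · exact Real.continuous_sin
    · exact continuous_const
  have hcoord : ∀ t : ℝ, equatorCoord (c t) = Complex.exp (t * Complex.I) := by
    intro t
    rw [Complex.exp_mul_I]
    apply Complex.ext <;> simp [equatorCoord, c, Complex.cos_ofReal_re, Complex.sin_ofReal_re]
  have h1 : ∀ t : ℝ, Complex.exp (g (c t) + 2 * (t * Complex.I)) = 1 := by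
    intro t
    have h2 := h (c t)
    simp only [hcoord, ← Complex.exp_conj, map_mul, Complex.conj_ofReal, Complex.conj_I] at h2
    rw [← Complex.exp_add] at h2
    have h3 : g (c t) + 2 * (t * Complex.I) = (t * Complex.I + g (c t)) - (t * -Complex.I) := by
      ring
    rw [h3, Complex.exp_sub, ← h2, div_self (Complex.exp_ne_zero _)]
  have h4 : ∀ t : ℝ, ∃ n : ℤ, (g (c t)).im + 2 * t = n * (2 * Real.pi) := by
    intro t
    obtain ⟨n, hn⟩ := Complex.exp_eq_one_iff.1 (h1 t)
    refine ⟨n, ?_⟩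
    have := congrArg Complex.im hn
    simpa using this
  choose n hn using h4
  have hnc : Continuous n := by
    rw [Int.isClosedEmbedding_coe_real.isInducing.continuous_iff]
    have : ((↑) : ℤ → ℝ) ∘ n = fun t => ((g (c t)).im + 2 * t) / (2 * Real.pi) := by
      funext t
      rw [hn t, mul_div_cancel_right₀ _ (by positivity)]
      rfl
    rw [this]
    exact ((Complex.continuous_im.comp (hg.comp hc)).add (by fun_prop)).div_const _
  have hconst : n (2 * Real.pi) = n 0 := PreconnectedSpace.constant inferInstance hnc
  have e1 := hn (2 * Real.pi)
  have e2 := hn 0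
  have hper : c (2 * Real.pi) = c 0 := by simp [c]
  rw [hconst, hper, ← e2] at e1
  have := Real.pi_pos
  linarith

/-- The angle of the image of the equator about a chord. -/
def loopAngle (φ : Sph 2 → Sph 2) (a b : Sph 2) (x : Equator) : ℂ :=
  chordAngle a.1 b.1 (φ east.1).1 (φ x.1).1

theorem loopAngle_swap (φ : Sph 2 → Sph 2) (a b : Sph 2) (x : Equator) :
    loopAngle φ b a x = starRingEnd ℂ (loopAngle φ a b x) := chordAngle_swap _ _ _ _

theorem loopAngle_ne_zero {φ : Sph 2 → Sph 2} {a b : Sph 2} (hab : a ≠ b)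
    (ha : ∀ x : Equator, φ x.1 ≠ a) (hb : ∀ x : Equator, φ x.1 ≠ b) (x : Equator) :
    loopAngle φ a b x ≠ 0 :=
  chordAngle_ne_zero (by simp) (by simp) (by simp) (by simp) (Subtype.coe_injective.ne hab)
    (Subtype.coe_injective.ne (ha east)) (Subtype.coe_injective.ne (hb east))
    (Subtype.coe_injective.ne (ha x)) (Subtype.coe_injective.ne (hb x))

theorem continuous_loopAngle {T : Type*} [TopologicalSpace T] {φ : T → Sph 2 → Sph 2}
    (hφ : Continuous (Function.uncurry φ)) {a b : T → Sph 2} (ha : Continuous a)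
    (hb : Continuous b) :
    Continuous (Function.uncurry fun t => loopAngle (φ t) (a t) (b t)) := by
  have h1 : Continuous fun p : T × Equator => φ p.1 east.1 :=
    hφ.comp (continuous_fst.prodMk continuous_const)
  have h2 : Continuous fun p : T × Equator => φ p.1 p.2.1 :=
    hφ.comp (continuous_fst.prodMk (continuous_subtype_val.comp continuous_snd))
  let q : T × Equator → E3 × E3 × E3 × E3 := fun p =>
    ((a p.1).1, (b p.1).1, (φ p.1 east.1).1, (φ p.1 p.2.1).1)
  have hq : Continuous q := by fun_prop
  have h3 : (Function.uncurry fun t => loopAngle (φ t) (a t) (b t)) =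
      (fun q : E3 × E3 × E3 × E3 => chordAngle q.1 q.2.1 q.2.2.1 q.2.2.2) ∘ q := by
    funext p
    simp only [Function.uncurry, loopAngle, Function.comp_apply, q]
  rw [h3]
  exact continuous_chordAngle.comp hq

theorem aimLast_north : aimLast 2 (axis 2) = 1 :=
  aimLast_eq_one_iff.2 (by simp [axis_apply])

theorem aimLast_south : aimLast 2 (-axis 2) = -1 :=
  aimLast_eq_neg_one_iff.2 (by simp [axis_apply])

/-- The winding of the image of the equator about the chord joining the images of the poles is
constant on the connected component of the identity, because injectivity keeps that loop away from
the ends of the chord. So it can be computed at the identity. -/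
theorem IsPos.sameWinding_poles {φ : Sph 2 ≃ₜ Sph 2} (hφ : IsPos φ) :
    SameWinding (loopAngle φ (φ (axis 2)) (φ (-axis 2))) equatorCoord := by
  set F : Set C(Sph 2, Sph 2) := {f | IsHomeomorph f} with hF
  set K := connectedComponentIn F (ContinuousMap.id _) with hK
  have : PreconnectedSpace K := Subtype.preconnectedSpace isPreconnected_connectedComponentIn
  have hev : Continuous (Function.uncurry fun f : K => (f.1 : Sph 2 → Sph 2)) :=
    ContinuousEval.continuous_eval.comp
      ((continuous_subtype_val.comp continuous_fst).prodMk continuous_snd)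
  have hconst : ∀ y : Sph 2, Continuous fun f : K => f.1 y := fun y =>
    hev.comp (continuous_id.prodMk continuous_const)
  have hinj : ∀ f : K, Function.Injective f.1 := fun f =>
    IsHomeomorph.injective (connectedComponentIn_subset F _ f.2)
  have hpole : axis 2 ≠ -axis 2 := fun h => by
    have := aimLast_north
    rw [h, aimLast_south] at this
    exact absurd this (by decide)
  have key := SameWinding.of_connected
    (continuous_loopAngle hev (hconst (axis 2)) (hconst (-axis 2)))
    (fun f => loopAngle_ne_zero ((hinj f).ne hpole)
      (fun x => (hinj f).ne fun h => by
        have := x.2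
        rw [h, aimLast_north] at this
        exact absurd this (by decide))
      (fun x => (hinj f).ne fun h => by
        have := x.2
        rw [h, aimLast_south] at this
        exact absurd this (by decide)))
    ⟨toC φ, hφ⟩ ⟨ContinuousMap.id _, mem_connectedComponentIn id_mem_homeos⟩
  -- At the identity the chord has length 2, and the angle function is the coordinate of the equator
  -- times 2² = 4.
  refine SameWinding.trans key ⟨fun _ => Complex.log 4, continuous_const, fun x => ?_⟩
  rw [Complex.exp_log (by norm_num)]
  have hx : x.1.1 2 = 0 := aimLast_eq_zero_iff.1 x.2
  have hnorm : ‖(axis 2).1 - (-axis 2 : Sph 2).1‖ = 2 := by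
    have h1 : (axis 2).1 - (-axis 2 : Sph 2).1 = (2 : ℝ) • (axis 2).1 := by
      simp [two_smul]
    rw [h1, norm_smul]
    simp
  show chordAngle (axis 2).1 (-axis 2 : Sph 2).1 (axis 0).1 x.1.1 = equatorCoord x * 4
  apply Complex.ext
  · simp only [chordAngle, hnorm, inner_E3]
    simp [axis_apply, equatorCoord, hx]
    ring
  · simp only [chordAngle, hnorm]
    simp [axis_apply, equatorCoord, hx]
    ring

/-- A parameterization in `hom⁺` of a pseudosphere runs once around in the positive direction. -/
theorem IsPos.sameWinding {φ : Sph 2 ≃ₜ Sph 2} (hφ : IsPos φ) {θ : Sph 2 → SignType}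
    (hθ : θ ∘ φ = aimLast 2) {a b : Sph 2} (ha : θ a = 1) (hb : θ b = -1) :
    SameWinding (loopAngle φ a b) equatorCoord := by
  -- The ends of the chord are moved to the images of the poles within the two open sides of the
  -- pseudosphere, which are connected and miss the image of the equator.
  let T := {u : Sph 2 | aimLast 2 u = 1} ×ˢ {u : Sph 2 | aimLast 2 u = -1}
  have : PreconnectedSpace T := Subtype.preconnectedSpace
    (isPreconnected_aimLast_eq_one.prod isPreconnected_aimLast_eq_neg_one)
  have hθ' : ∀ u, aimLast 2 (φ.symm u) = θ u := fun u => by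
    rw [← hθ, Function.comp_apply, φ.apply_symm_apply]
  have key := SameWinding.of_connected (T := T) (E := Equator)
    (G := fun t => loopAngle φ (φ t.1.1) (φ t.1.2))
    (continuous_loopAngle (φ := fun _ => φ) (φ.continuous.comp continuous_snd)
      (φ.continuous.comp (continuous_fst.comp continuous_subtype_val))
      (φ.continuous.comp (continuous_snd.comp continuous_subtype_val)))
    (fun t => loopAngle_ne_zero
      (φ.injective.ne fun h => by
        have h1 := t.2.1
        have h2 := t.2.2
        simp only [mem_ofPred_eq] at h1 h2
        rw [h, h2] at h1
        exact absurd h1 (by decide))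
      (fun x => φ.injective.ne fun h => by
        have h1 := t.2.1
        simp only [mem_ofPred_eq] at h1
        rw [← h, x.2] at h1
        exact absurd h1 (by decide))
      (fun x => φ.injective.ne fun h => by
        have h1 := t.2.2
        simp only [mem_ofPred_eq] at h1
        rw [← h, x.2] at h1
        exact absurd h1 (by decide)))
    ⟨(φ.symm a, φ.symm b), (hθ' a).trans ha, (hθ' b).trans hb⟩
    ⟨(axis 2, -axis 2), aimLast_north, aimLast_south⟩
  simp only [φ.apply_symm_apply] at key
  exact key.trans hφ.sameWinding_poles

/-! ### The sides of a pseudosphere -/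

theorem preimage_aim_eq_image {θ : Sph 2 → SignType} {φ : Sph 2 ≃ₜ Sph 2}
    (h : θ ∘ φ = aimLast 2) (s : SignType) : θ ⁻¹' {s} = φ '' (aimLast 2 ⁻¹' {s}) := by
  rw [← h, preimage_comp, image_preimage_eq _ φ.surjective]

theorem IsPseudosphere.isOpen_preimage {θ : Sph 2 → SignType} (hθ : IsPseudosphere θ)
    {s : SignType} (hs : s ≠ 0) : IsOpen (θ ⁻¹' {s}) := by
  obtain ⟨φ, -, h⟩ := hθ
  rw [preimage_aim_eq_image h, φ.isOpen_image]
  rcases SignType.trichotomy s with rfl | rfl | rfl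
  · have : aimLast 2 ⁻¹' {-1} = {x : Sph 2 | x.1 2 < 0} := by
      ext x; exact aimLast_eq_neg_one_iff
    rw [this]
    exact isOpen_lt (continuous_sph_apply 2) continuous_const
  · exact absurd rfl hs
  · have : aimLast 2 ⁻¹' {1} = {x : Sph 2 | 0 < x.1 2} := by
      ext x; exact aimLast_eq_one_iff
    rw [this]
    exact isOpen_lt continuous_const (continuous_sph_apply 2)

theorem IsPseudosphere.isClosed_ker {θ : Sph 2 → SignType} (hθ : IsPseudosphere θ) :
    IsClosed (θ ⁻¹' {0}) := by
  have : θ ⁻¹' {0} = (θ ⁻¹' {1} ∪ θ ⁻¹' {-1})ᶜ := by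
    ext x
    rcases SignType.trichotomy (θ x) with h | h | h <;> simp [h]
  rw [this]
  exact ((hθ.isOpen_preimage (by decide)).union (hθ.isOpen_preimage (by decide))).isClosed_compl

theorem IsPseudosphere.isPreconnected_preimage {θ : Sph 2 → SignType} (hθ : IsPseudosphere θ)
    {s : SignType} (hs : s ≠ 0) : IsPreconnected (θ ⁻¹' {s}) := by
  obtain ⟨φ, -, h⟩ := hθ
  rw [preimage_aim_eq_image h]
  refine IsPreconnected.image ?_ _ φ.continuous.continuousOn
  rcases SignType.trichotomy s with rfl | rfl | rfl
  · exact isPreconnected_aimLast_eq_neg_one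
  · exact absurd rfl hs
  · exact isPreconnected_aimLast_eq_one

theorem IsPseudosphere.exists_eq {θ : Sph 2 → SignType} (hθ : IsPseudosphere θ) (s : SignType) :
    ∃ x, θ x = s := by
  obtain ⟨φ, -, h⟩ := hθ
  have : ∃ x, aimLast 2 x = s := by
    rcases SignType.trichotomy s with rfl | rfl | rfl
    · exact ⟨_, aimLast_south⟩
    · exact ⟨_, east.2⟩
    · exact ⟨_, aimLast_north⟩
  obtain ⟨x, hx⟩ := this
  exact ⟨φ x, (congrFun h x).trans hx⟩

/-- A connected set that misses the kernel of a pseudosphere lies on one side of it. -/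
theorem IsPseudosphere.exists_sign_of_isPreconnected {θ : Sph 2 → SignType}
    (hθ : IsPseudosphere θ) {H : Set (Sph 2)} (hH : IsPreconnected H) (h0 : ∀ x ∈ H, θ x ≠ 0) :
    ∃ s : SignType, s ≠ 0 ∧ ∀ x ∈ H, θ x = s := by
  have hd : Disjoint (θ ⁻¹' {1}) (θ ⁻¹' {-1}) := by
    rw [Set.disjoint_left]
    intro x h1 h2
    simp only [mem_preimage, mem_singleton_iff] at h1 h2
    rw [h1] at h2
    exact absurd h2 (by decide)
  have hsub : H ⊆ θ ⁻¹' {1} ∪ θ ⁻¹' {-1} := by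
    intro x hx
    rcases SignType.trichotomy (θ x) with h | h | h
    · exact Or.inr h
    · exact absurd h (h0 x hx)
    · exact Or.inl h
  rcases hH.subset_or_subset (hθ.isOpen_preimage (by decide)) (hθ.isOpen_preimage (by decide)) hd
    hsub with h | h
  · exact ⟨1, by decide, fun x hx => h hx⟩
  · exact ⟨-1, by decide, fun x hx => h hx⟩

/-- Two pseudospheres with the same kernel are equal or opposite. -/
theorem IsPseudosphere.eq_or_eq_neg {θ η : Sph 2 → SignType} (hθ : IsPseudosphere θ)
    (hη : IsPseudosphere η) (h : ∀ x, θ x = 0 ↔ η x = 0) : η = θ ∨ η = -θ := by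
  have side : ∀ s : SignType, s ≠ 0 → ∃ t : SignType, t ≠ 0 ∧ ∀ x ∈ θ ⁻¹' {s}, η x = t :=
    fun s hs => hη.exists_sign_of_isPreconnected (hθ.isPreconnected_preimage hs) fun x hx h0 => by
      have h1 := (h x).2 h0
      rw [show θ x = s from hx] at h1
      exact hs h1
  obtain ⟨t, ht, h1⟩ := side 1 (by decide)
  obtain ⟨u, hu, h2⟩ := side (-1) (by decide)
  -- If η had the same sign on both sides of θ, it would omit the opposite sign, but a pseudosphere
  -- takes all three values.
  have htu : u = -t := by
    by_contra hne
    have hsign : ∀ t u : SignType, t ≠ 0 → u ≠ 0 → u ≠ -t → u = t := by decide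
    have hneg : ∀ t : SignType, t ≠ 0 → t ≠ -t ∧ 0 ≠ -t := by decide
    have : u = t := hsign t u ht hu hne
    obtain ⟨x, hx⟩ := hη.exists_eq (-t)
    rcases SignType.trichotomy (θ x) with h' | h' | h'
    · rw [h2 x h', this] at hx
      exact (hneg t ht).1 hx
    · rw [(h x).1 h'] at hx
      exact (hneg t ht).2 hx
    · rw [h1 x h'] at hx
      exact (hneg t ht).1 hx
  rcases SignType.trichotomy t with rfl | rfl | rfl
  · right
    funext x
    rcases SignType.trichotomy (θ x) with h' | h' | h'
    · rw [h2 x h', htu, Pi.neg_apply, h']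
    · rw [(h x).1 h', Pi.neg_apply, h', neg_zero]
    · rw [h1 x h', Pi.neg_apply, h']
  · exact absurd rfl ht
  · left
    funext x
    rcases SignType.trichotomy (θ x) with h' | h' | h'
    · rw [h2 x h', htu, h']
    · rw [(h x).1 h', h']
    · rw [h1 x h', h']

/-! ### Weighted pseudospheres at distance zero -/

theorem wdist_lt_iff {α β : WPS} {ε : ℝ≥0∞} : edist α β < ε ↔
    ∃ φ ψ, α.Param φ ∧ β.Param ψ ∧ gap α.weight β.weight φ ψ < ε := by
  show wdist α β < ε ↔ _
  simp only [wdist, iInf_lt_iff, Subtype.exists, exists_prop]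
  constructor
  · rintro ⟨φ, hφ, ψ, hψ, h⟩
    exact ⟨φ, ψ, hφ, hψ, h⟩
  · rintro ⟨φ, ψ, hφ, hψ, h⟩
    exact ⟨φ, hφ, ψ, hψ, h⟩

theorem WPS.weight_nonneg (α : WPS) : 0 ≤ α.weight := by
  rcases α.valid with ⟨h, -⟩ | ⟨h, -⟩
  · exact h.le
  · exact h.ge

/-- At each point of the equator the two vectors compared in `gap` have the weights as their norms.
-/
theorem edist_weight_le (α β : WPS) : edist α.weight β.weight ≤ edist α β := by
  refine le_of_forall_gt fun ε hε => ?_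
  obtain ⟨φ, ψ, -, -, h⟩ := wdist_lt_iff.1 hε
  refine lt_of_le_of_lt ?_ h
  refine le_trans ?_ (le_iSup (fun x : Equator =>
    edist (α.weight • (φ x.1).1) (β.weight • (ψ x.1).1)) east)
  have h1 : ∀ (r : ℝ) (x : Sph 2), 0 ≤ r → ‖r • x.1‖ = r := fun r x hr => by
    rw [norm_smul, Real.norm_of_nonneg hr]; simp
  rw [edist_dist, edist_dist]
  refine ENNReal.ofReal_le_ofReal ?_
  rw [dist_eq_norm, dist_eq_norm, Real.norm_eq_abs]
  conv_lhs => rw [← h1 _ (φ east.1) α.weight_nonneg, ← h1 _ (ψ east.1) β.weight_nonneg]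
  exact abs_norm_sub_norm_le _ _

/-- If `β` is at distance zero from `α`, then every parameterization of `α` is on the equator
a uniform limit of parameterizations of `β`. -/
theorem exists_param_near {α β : WPS} (h : edist α β = 0) (hα : 0 < α.weight)
    {φ : Sph 2 ≃ₜ Sph 2} (hφ : α.Param φ) {δ : ℝ} (hδ : 0 < δ) :
    ∃ ψ, β.Param ψ ∧ ∀ x : Equator, dist (ψ x.1) (φ x.1) < δ := by
  have hw : α.weight = β.weight := by
    have := edist_weight_le α β
    rw [h] at this
    exact edist_eq_zero.1 (le_antisymm this bot_le)
  have hε : edist α β < ENNReal.ofReal (α.weight * δ) := by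
    rw [h]; exact ENNReal.ofReal_pos.2 (by positivity)
  obtain ⟨φ', ψ', hφ', hψ', hgap⟩ := wdist_lt_iff.1 hε
  -- A nearly optimal pair (φ', ψ') is reparameterized by a homeomorphism that preserves the equator
  -- and turns φ' into the given φ.
  let k : Sph 2 ≃ₜ Sph 2 := φ.trans φ'.symm
  have hk : aimLast 2 ∘ k = aimLast 2 := by
    rw [← hφ'.2 hα.ne']
    conv_rhs => rw [hφ'.2 hα.ne', ← hφ.2 hα.ne']
    funext x
    simp [k]
  refine ⟨k.trans ψ', ⟨(hφ.1.trans hφ'.1.symm).trans hψ'.1, fun h0 => ?_⟩, fun x => ?_⟩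
  · calc β.aim ∘ (k.trans ψ') = (β.aim ∘ ψ') ∘ k := rfl
      _ = aimLast 2 := by rw [hψ'.2 h0, hk]
  · have h1 := (le_iSup (fun x : Equator =>
      edist (α.weight • (φ' x.1).1) (β.weight • (ψ' x.1).1))
      ⟨k x.1, (congrFun hk x.1).trans x.2⟩).trans_lt hgap
    simp only [← hw] at h1
    rw [edist_dist, ENNReal.ofReal_lt_ofReal_iff (by positivity), dist_smul₀,
      Real.norm_of_nonneg hα.le] at h1
    have h2 := lt_of_mul_lt_mul_left h1 hα.le
    have h3 : φ' (k x.1) = φ x.1 := by simp [k]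
    rw [h3, dist_comm] at h2
    exact h2

/-- A point of the kernel of α is a limit of points of the kernel of β, which is closed. -/
theorem aim_eq_zero_of_edist_eq_zero {α β : WPS} (h : edist α β = 0) (hα : 0 < α.weight)
    {x : Sph 2} (hx : α.aim x = 0) : β.aim x = 0 := by
  obtain ⟨φ, hφ⟩ := α.exists_param
  rcases β.valid with ⟨hβ, hβ'⟩ | ⟨-, h0⟩
  · have hmem : x ∈ closure (β.aim ⁻¹' {0}) := by
      refine Metric.mem_closure_iff.2 fun δ hδ => ?_
      obtain ⟨ψ, hψ, hd⟩ := exists_param_near h hα hφ hδ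
      have hy : aimLast 2 (φ.symm x) = 0 := by
        rw [← hφ.2 hα.ne', Function.comp_apply, φ.apply_symm_apply, hx]
      refine ⟨ψ (φ.symm x), (congrFun (hψ.2 hβ.ne') _).trans hy, ?_⟩
      have := hd ⟨_, hy⟩
      rwa [φ.apply_symm_apply, dist_comm] at this
    rwa [hβ'.isClosed_ker.closure_eq] at hmem
  · rw [h0]; rfl

theorem continuous_chordAngle_right (a b : E3) :
    Continuous fun q : Sph 2 × Sph 2 => chordAngle a b q.1.1 q.2.1 := by
  let q : Sph 2 × Sph 2 → E3 × E3 × E3 × E3 := fun p => (a, b, p.1.1, p.2.1)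
  have hq : Continuous q := by fun_prop
  have h : (fun q : Sph 2 × Sph 2 => chordAngle a b q.1.1 q.2.1) =
      (fun q : E3 × E3 × E3 × E3 => chordAngle q.1 q.2.1 q.2.2.1 q.2.2.2) ∘ q := by
    funext p
    simp only [Function.comp_apply, q]
  rw [h]
  exact continuous_chordAngle.comp hq

/-- The angle function of φ has a positive minimum modulus on the compact equator, and the chord
angle is uniformly continuous in the base point and the moving point. -/
theorem exists_sameWinding_of_near (φ : Sph 2 ≃ₜ Sph 2) {a b : Sph 2}
    (h0 : ∀ x, loopAngle φ a b x ≠ 0) : ∃ δ > 0, ∀ ψ : Sph 2 ≃ₜ Sph 2,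
      (∀ x : Equator, dist (ψ x.1) (φ x.1) < δ) →
        SameWinding (loopAngle ψ a b) (loopAngle φ a b) := by
  have hF := continuous_chordAngle_right a.1 b.1
  have hcont : ∀ ψ : Sph 2 ≃ₜ Sph 2, Continuous (loopAngle ψ a b) := fun ψ => by
    have hψ : Continuous fun x : Equator => (ψ east.1, ψ x.1) :=
      continuous_const.prodMk (ψ.continuous.comp continuous_subtype_val)
    have h : loopAngle ψ a b = (fun q : Sph 2 × Sph 2 => chordAngle a.1 b.1 q.1.1 q.2.1) ∘
        fun x : Equator => (ψ east.1, ψ x.1) := by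
      funext x
      simp only [loopAngle, Function.comp_apply]
    rw [h]
    exact hF.comp hψ
  obtain ⟨x₀, -, hx₀⟩ := isCompact_univ.exists_isMinOn (⟨east, trivial⟩ : univ.Nonempty)
    (hcont φ).norm.continuousOn
  obtain ⟨δ, hδ, hδ'⟩ := Metric.uniformContinuous_iff.1
    (CompactSpace.uniformContinuous_of_continuous hF) _ (norm_pos_iff.2 (h0 x₀))
  refine ⟨δ, hδ, fun ψ hd => SameWinding.of_norm_sub_lt (hcont ψ) (hcont φ) fun x => ?_⟩
  rw [← dist_eq_norm]
  have hq : dist (ψ east.1, ψ x.1) (φ east.1, φ x.1) < δ := by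
    rw [Prod.dist_eq]
    exact max_lt (hd east) (hd x)
  exact (hδ' hq).trans_le (hx₀ (mem_univ x))

/-- A parameterization φ of α winds positively about the chord from a to b, and one of β = -α about
the chord from b to a. Were the distance zero, the second could be chosen uniformly close to φ on
the equator, so both would wind alike about the same chord, and a positive loop would be equivalent
to its conjugate. -/
theorem not_edist_eq_zero_of_aim_eq_neg {α β : WPS} (hα : 0 < α.weight) (hβ : 0 < β.weight)
    (hn : β.aim = -α.aim) : edist α β ≠ 0 := by
  intro h
  obtain ⟨φ, hφ⟩ := α.exists_param
  have hφα := hφ.2 hα.ne'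
  set a := φ (axis 2) with ha
  set b := φ (-axis 2) with hb
  have hαa : α.aim a = 1 := (congrFun hφα _).trans aimLast_north
  have hαb : α.aim b = -1 := (congrFun hφα _).trans aimLast_south
  have hβa : β.aim a = -1 := by rw [hn, Pi.neg_apply, hαa]
  have hβb : β.aim b = 1 := by rw [hn, Pi.neg_apply, hαb, neg_neg]
  have hφx : ∀ x : Equator, α.aim (φ x.1) = 0 := fun x => (congrFun hφα _).trans x.2
  have hne : ∀ x, loopAngle φ b a x ≠ 0 := by
    refine loopAngle_ne_zero ?_ (fun x hx => ?_) (fun x hx => ?_)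
    · intro hab
      rw [hab, hαa] at hαb
      exact absurd hαb (by decide)
    · have := hφx x
      rw [hx, hαb] at this
      exact absurd this (by decide)
    · have := hφx x
      rw [hx, hαa] at this
      exact absurd this (by decide)
  obtain ⟨δ, hδ, hnear⟩ := exists_sameWinding_of_near φ hne
  obtain ⟨ψ, hψ, hd⟩ := exists_param_near h hα hφ hδ
  have hclose := hnear ψ hd
  have h1 : SameWinding (loopAngle φ a b) equatorCoord := hφ.1.sameWinding hφα hαa hαb
  have h2 : SameWinding (loopAngle ψ b a) equatorCoord :=
    hψ.1.sameWinding (hψ.2 hβ.ne') hβb hβa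
  have h3 : SameWinding (loopAngle φ b a) (fun x => starRingEnd ℂ (equatorCoord x)) := by
    have h4 := h1.conj
    simp only [← loopAngle_swap] at h4
    exact h4
  exact not_sameWinding_conj_equatorCoord (h3.symm.trans (hclose.symm.trans h2))

/-- The weighted Fréchet distance separates weighted pseudospheres. -/
theorem WPS.eq_of_edist_eq_zero {α β : WPS} (h : edist α β = 0) : α = β := by
  have hw : α.weight = β.weight := by
    have := edist_weight_le α β
    rw [h] at this
    exact edist_eq_zero.1 (le_antisymm this bot_le)
  refine WPS.ext hw ?_
  rcases α.valid with ⟨hα, hα'⟩ | ⟨hα, hα'⟩ <;> rcases β.valid with ⟨hβ, hβ'⟩ | ⟨hβ, hβ'⟩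
  · rcases hα'.eq_or_eq_neg hβ' fun x => ⟨aim_eq_zero_of_edist_eq_zero h hα,
      aim_eq_zero_of_edist_eq_zero ((edist_comm _ _).trans h) hβ⟩ with h' | h'
    · exact h'.symm
    · exact absurd h (not_edist_eq_zero_of_aim_eq_neg hα hβ h')
  · exact absurd (hw.trans hβ) hα.ne'
  · exact absurd (hw.symm.trans hα) hβ.ne'
  · rw [hα', hβ']

/-! ### The topology of the orthogonal group -/

theorem continuous_mv : Continuous fun p : O3 × E3 => mv p.1 p.2 :=
  (PiLp.continuous_toLp 2 _).comp
    ((continuous_subtype_val.comp continuous_fst).matrix_mulVec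
      ((PiLp.continuous_ofLp 2 _).comp continuous_snd))

instance : CompactSpace O3 := by
  refine isCompact_iff_compactSpace.1 ?_
  have hsub : ((Matrix.orthogonalGroup (Fin 3) ℝ : Set (Matrix (Fin 3) (Fin 3) ℝ))) ⊆
      Set.pi univ fun _ => Set.pi univ fun _ => Icc (-1) 1 := by
    intro Q hQ i _ j _
    have := entry_norm_bound_of_unitary hQ i j
    exact abs_le.1 this
  refine IsCompact.of_isClosed_subset
    (isCompact_univ_pi fun _ => isCompact_univ_pi fun _ => isCompact_Icc) ?_ hsub
  exact isClosed_unitary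

/-! ### Orientation preserving isometries of the sphere -/

theorem reflection_orthogonal_span_zero : Submodule.reflection (Submodule.span ℝ {(0 : E3)})ᗮ = 1 := by
  ext1 x
  exact (Submodule.reflection_eq_self_iff x).2 (by simp)

theorem reflHomeo_eq_unit {v : E3} (hv : v ≠ 0) : ∃ u : Sph 2, reflHomeo v = reflHomeo u.1 := by
  let u : Sph 2 := ⟨‖v‖⁻¹ • v, by simp [norm_smul, hv]⟩
  refine ⟨u, ?_⟩
  have : Submodule.span ℝ {u.1} = Submodule.span ℝ {v} :=
    Submodule.span_singleton_smul_eq (IsUnit.mk0 _ (by simp [hv])) v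
  unfold reflHomeo
  simp only [this]

theorem det_reflection_orthogonal_singleton {v : E3} (hv : v ≠ 0) :
    LinearMap.det (Submodule.reflection (Submodule.span ℝ {v})ᗮ).toLinearMap = (-1 : ℝ) := by
  rw [Submodule.det_reflection, Submodule.orthogonal_orthogonal, finrank_span_singleton hv, pow_one]

/-- A linear isometry of determinant `1` lies in `hom⁺`, and one of determinant `-1`
does so after composition with a reflection. -/
theorem isPos_sphHomeo (L : E3 ≃ₗᵢ[ℝ] E3) :
    (LinearMap.det L.toLinearMap = (1 : ℝ) ∧ IsPos (sphHomeo L)) ∨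
    (LinearMap.det L.toLinearMap = (-1 : ℝ) ∧
      IsPos ((reflHomeo (axis 0).1).trans (sphHomeo L))) := by
  obtain ⟨l, -, rfl⟩ := L.reflections_generate_dim
  induction l with
  | nil =>
    left
    refine ⟨?_, ?_⟩
    · simp only [List.map_nil, List.prod_nil]
      exact LinearMap.det_id
    · have h1 : sphHomeo (1 : E3 ≃ₗᵢ[ℝ] E3) = Homeomorph.refl _ := by ext1 x; rfl
      simp only [List.map_nil, List.prod_nil, h1]
      exact IsPos.refl
  | cons v l ih =>
    simp only [List.map_cons, List.prod_cons]
    set K := (l.map fun v => Submodule.reflection (Submodule.span ℝ {v})ᗮ).prod with hK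
    by_cases hv : v = 0
    · rw [hv, reflection_orthogonal_span_zero, one_mul]
      exact ih
    · have hdet : LinearMap.det (Submodule.reflection (Submodule.span ℝ {v})ᗮ * K).toLinearMap =
          -LinearMap.det K.toLinearMap := by
        rw [← neg_one_mul, ← det_reflection_orthogonal_singleton hv, ← LinearMap.det_comp]
        rfl
      obtain ⟨u, hu⟩ := reflHomeo_eq_unit hv
      have hpos := isPos_refl_refl u (axis 0)
      rw [← hu] at hpos
      rcases ih with ⟨h1, h2⟩ | ⟨h1, h2⟩
      · right
        refine ⟨by rw [hdet, h1], ?_⟩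
        exact h2.sandwich (reflHomeo v) (reflHomeo (axis 0).1) hpos
      · left
        refine ⟨by rw [hdet, h1, neg_neg], ?_⟩
        convert h2.sandwich (reflHomeo v) (reflHomeo (axis 0).1) hpos using 1
        ext1 x
        simp only [Homeomorph.trans_apply, reflHomeo_reflHomeo]
        rfl

theorem det_orthLI (Q : O3) : LinearMap.det (orthLI Q).toLinearMap = Q.1.det := by
  rw [← LinearMap.det_toLin (EuclideanSpace.basisFun (Fin 3) ℝ).toBasis Q.1]
  congr 1

theorem aimLast_comp_reflHomeo_axis : aimLast 2 ∘ reflHomeo (axis 0).1 = aimLast 2 := by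
  funext x
  rw [Function.comp_apply, aimLast, aimLast, reflHomeo_coe]
  congr 1
  simp [axis]

/-! ### Continuity of the action on weighted pseudospheres -/

theorem orthHomeo_inv_apply (Q : O3) (x : Sph 2) : orthHomeo Q (orthHomeo Q⁻¹ x) = x := by
  rw [← orthHomeo_mul, mul_inv_cancel, orthHomeo_one]

/-- Q⁻¹ ∘ φ parameterizes α * Q but leaves hom⁺ when det Q = -1; precomposing with a reflection that
preserves the last coordinate repairs this. The correction `R` depends on Q alone, so it serves two
weighted pseudospheres at once and merely reparameterizes the equator in their gap. -/
theorem exists_param_smul (Q : O3) : ∃ R : Sph 2 ≃ₜ Sph 2, aimLast 2 ∘ R = aimLast 2 ∧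
    (Q.1.det = 1 → R = Homeomorph.refl _) ∧
    ∀ (α : WPS) (φ : Sph 2 ≃ₜ Sph 2), α.Param φ →
      (op Q • α).Param ((R.trans φ).trans (orthHomeo Q⁻¹)) := by
  have haim : ∀ (R : Sph 2 ≃ₜ Sph 2), aimLast 2 ∘ R = aimLast 2 → ∀ (α : WPS)
      (φ : Sph 2 ≃ₜ Sph 2), α.Param φ → (op Q • α).weight ≠ 0 →
      (op Q • α).aim ∘ ((R.trans φ).trans (orthHomeo Q⁻¹)) = aimLast 2 := by
    intro R hR α φ hφ h0
    have h1 := hφ.2 h0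
    funext x
    show α.aim (orthHomeo Q (orthHomeo Q⁻¹ (φ (R x)))) = _
    rw [orthHomeo_inv_apply]
    exact (congrFun h1 (R x)).trans (congrFun hR x)
  have hQ : (Q⁻¹).1.det = Q.1.det := by
    show (star Q.1).det = _
    rw [Matrix.star_eq_conjTranspose, Matrix.det_conjTranspose, star_trivial]
  rcases isPos_sphHomeo (orthLI Q⁻¹) with ⟨hd, h⟩ | ⟨hd, h⟩
  · refine ⟨Homeomorph.refl _, rfl, fun _ => rfl, fun α φ hφ => ⟨hφ.1.trans h, ?_⟩⟩
    exact haim _ rfl α φ hφ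
  · refine ⟨reflHomeo (axis 0).1, aimLast_comp_reflHomeo_axis, fun h1 => ?_, fun α φ hφ =>
      ⟨hφ.1.sandwich _ _ h, haim _ aimLast_comp_reflHomeo_axis α φ hφ⟩⟩
    rw [det_orthLI, hQ, h1] at hd
    norm_num at hd

theorem gap_trans_orthHomeo (r s : ℝ) (φ ψ : Sph 2 ≃ₜ Sph 2) (Q : O3) :
    gap r s (φ.trans (orthHomeo Q)) (ψ.trans (orthHomeo Q)) = gap r s φ ψ := by
  unfold gap
  congr 1
  funext x
  show edist (r • orthLI Q (φ x.1).1) (s • orthLI Q (ψ x.1).1) = _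
  rw [← map_smul, ← map_smul, LinearIsometryEquiv.edist_map]

theorem edist_smul_le (Q : O3) (α β : WPS) : edist (op Q • α) (op Q • β) ≤ edist α β := by
  obtain ⟨R, hR, -, hparam⟩ := exists_param_smul Q
  refine le_of_forall_gt fun ε hε => ?_
  obtain ⟨φ, ψ, hφ, hψ, h⟩ := wdist_lt_iff.1 hε
  refine wdist_lt_iff.2 ⟨_, _, hparam α φ hφ, hparam β ψ hψ, lt_of_le_of_lt ?_ h⟩
  rw [gap_trans_orthHomeo]
  exact gap_comp_le _ _ _ _ _ hR

instance : IsIsometricSMul O3ᵐᵒᵖ WPS where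
  isometry_smul Q α β := by
    refine le_antisymm (edist_smul_le Q.unop α β) ?_
    have := edist_smul_le Q.unop⁻¹ (Q • α) (Q • β)
    rwa [op_inv, MulOpposite.op_unop, inv_smul_smul, inv_smul_smul] at this

/-- The determinant is continuous and takes only the values 1 and -1. -/
theorem eventually_det_eq_one : ∀ᶠ Q : O3 in 𝓝 1, Q.1.det = 1 := by
  have hc : Continuous fun Q : O3 => Q.1.det := continuous_subtype_val.matrix_det
  have h : ∀ᶠ Q : O3 in 𝓝 1, 0 < Q.1.det :=
    hc.continuousAt.eventually (lt_mem_nhds (by simp))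
  filter_upwards [h] with Q hQ
  rcases isPos_sphHomeo (orthLI Q) with ⟨hd, -⟩ | ⟨hd, -⟩
  · rwa [det_orthLI] at hd
  · rw [det_orthLI] at hd
    linarith

theorem eventually_dist_orthHomeo_lt {ε : ℝ} (hε : 0 < ε) :
    ∀ᶠ Q : O3 in 𝓝 1, ∀ x : Sph 2, dist (orthHomeo Q⁻¹ x).1 x.1 < ε := by
  have key : ∀ᶠ Q : O3 in 𝓝 1, ∀ x ∈ (univ : Set (Sph 2)), dist (mv Q⁻¹ x.1) x.1 < ε := by
    refine isCompact_univ.eventually_forall_of_forall_eventually fun x _ => ?_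
    have hm : Continuous fun p : O3 × Sph 2 => mv p.1⁻¹ p.2.1 :=
      continuous_mv.comp (continuous_fst.inv.prodMk (continuous_subtype_val.comp continuous_snd))
    have hc : Continuous fun p : O3 × Sph 2 => dist (mv p.1⁻¹ p.2.1) p.2.1 :=
      hm.dist (continuous_subtype_val.comp continuous_snd)
    refine hc.continuousAt.eventually (gt_mem_nhds ?_)
    simpa [mv_one] using hε
  filter_upwards [key] with Q hQ x
  exact hQ x trivial

/-- Near 1 no correcting reflection is needed, so φ and Q⁻¹ ∘ φ can be compared directly, and they
differ by at most the displacement of Q⁻¹ on the sphere. -/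
theorem tendsto_edist_smul (α : WPS) :
    Filter.Tendsto (fun Q : O3 => edist (op Q • α) α) (𝓝 1) (𝓝 0) := by
  refine ENNReal.tendsto_nhds_zero.2 fun ε hε => ?_
  obtain ⟨δ, hδ, hδε⟩ : ∃ δ : ℝ, 0 < δ ∧ ENNReal.ofReal (α.weight * δ) ≤ ε := by
    by_cases h : ε = ⊤
    · exact ⟨1, one_pos, h ▸ le_top⟩
    · have h1 := ENNReal.toReal_pos hε.ne' h
      have h2 := α.weight_nonneg
      -- The added 1 keeps the denominator positive when the weight is zero.
      refine ⟨ε.toReal / (α.weight + 1), by positivity, ?_⟩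
      refine ENNReal.ofReal_le_of_le_toReal ?_
      rw [mul_div_assoc', div_le_iff₀ (by positivity)]
      nlinarith
  obtain ⟨φ, hφ⟩ := α.exists_param
  filter_upwards [eventually_det_eq_one, eventually_dist_orthHomeo_lt hδ] with Q hdet hQ
  obtain ⟨R, -, hR, hparam⟩ := exists_param_smul Q
  obtain rfl := hR hdet
  refine (iInf₂_le ⟨_, hparam α φ hφ⟩ ⟨φ, hφ⟩).trans (iSup_le fun x => le_trans ?_ hδε)
  show edist (α.weight • (orthHomeo Q⁻¹ (φ x.1)).1) (α.weight • (φ x.1).1) ≤ _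
  rw [edist_dist, dist_smul₀, Real.norm_of_nonneg α.weight_nonneg]
  exact ENNReal.ofReal_le_ofReal (mul_le_mul_of_nonneg_left (hQ _).le α.weight_nonneg)

/-- An isometric action of `O(3)` whose orbit maps are continuous at `1` is continuous. -/
theorem continuous_action_of_tendsto {Y : Type*} [PseudoEMetricSpace Y] [MulAction O3ᵐᵒᵖ Y]
    [IsIsometricSMul O3ᵐᵒᵖ Y]
    (h : ∀ y : Y, Filter.Tendsto (fun Q : O3 => edist (op Q • y) y) (𝓝 1) (𝓝 0)) :
    Continuous fun p : Y × O3 => op p.2 • p.1 := by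
  refine continuous_iff_continuousAt.2 fun ⟨y, Q⟩ => ?_
  refine tendsto_iff_edist_tendsto_0.2 ?_
  -- Compare through y * P, where P is the second entry of `p`: since the action is isometric, y * P
  -- and y * Q are as far apart as y * (P Q⁻¹) and y, so continuity at 1 suffices.
  have hle : ∀ p : Y × O3, edist (op p.2 • p.1) (op Q • y) ≤
      edist p.1 y + edist (op (p.2 * Q⁻¹) • y) y := by
    intro p
    refine (edist_triangle _ (op p.2 • y) _).trans (add_le_add (edist_smul_left _ _ _).le ?_)
    rw [← edist_smul_left (op Q⁻¹), smul_smul, smul_smul, ← op_mul, ← op_mul, mul_inv_cancel,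
      op_one, one_smul]
  refine tendsto_of_tendsto_of_tendsto_of_le_of_le tendsto_const_nhds ?_ (fun _ => bot_le) hle
  have h1 : Filter.Tendsto (fun p : Y × O3 => edist p.1 y) (𝓝 (y, Q)) (𝓝 0) :=
    tendsto_iff_edist_tendsto_0.1 (continuous_fst.tendsto (y, Q))
  have h2 : Filter.Tendsto (fun p : Y × O3 => p.2 * Q⁻¹) (𝓝 (y, Q)) (𝓝 1) := by
    have : Continuous fun p : Y × O3 => p.2 * Q⁻¹ := continuous_snd.mul continuous_const
    simpa using this.tendsto (y, Q)
  simpa using h1.add ((h y).comp h2)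

theorem continuous_action_wps : Continuous fun p : WPS × O3 => op p.2 • p.1 :=
  continuous_action_of_tendsto tendsto_edist_smul

/-! ### Orthogonal symmetries of a pseudosphere -/

theorem orthHomeo_eq_id {Q : O3} (h : ∀ x, orthHomeo Q x = x) : Q = 1 := by
  refine Subtype.ext (Matrix.ext_of_mulVec_single fun i => ?_)
  have := congrArg (fun x : Sph 2 => x.1.ofLp) (h (axis i))
  simp only [Submonoid.coe_one, Matrix.one_mulVec]
  exact this

/-- An orthogonal symmetry of a pseudosphere that fixes its kernel pointwise is trivial. -/
theorem IsPseudosphere.orth_eq_one {θ : Sph 2 → SignType} (hθ : IsPseudosphere θ) {Q : O3}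
    (hQ : ∀ x, θ (orthHomeo Q x) = θ x) (hfix : ∀ x, θ x = 0 → orthHomeo Q x = x) : Q = 1 := by
  refine orthHomeo_eq_id fun x => ?_
  by_contra hx
  set y := orthHomeo Q x with hy
  -- The plane orthogonal to n bisects x and y = Qx. A point fixed by Q has the same inner product
  -- with both, so the whole kernel lies in this plane, while x and y lie strictly on opposite
  -- sides.
  set n : E3 := y.1 - x.1 with hn
  have hn0 : n ≠ 0 := sub_ne_zero.2 fun h => hx (Subtype.ext h)
  have hnn : 0 < ‖n‖ ^ 2 := by have := norm_pos_iff.2 hn0; positivity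
  have hx1 : ‖x.1‖ ^ 2 = 1 := by simp
  have hy1 : ‖y.1‖ ^ 2 = 1 := by simp
  have hexp := norm_sub_sq_real y.1 x.1
  have hny : 0 < inner ℝ n y.1 := by
    rw [hn, inner_sub_left, real_inner_self_eq_norm_sq, real_inner_comm]
    rw [hn, hexp] at hnn
    linarith
  have hnx : 0 < inner ℝ (-n) x.1 := by
    rw [inner_neg_left, hn, inner_sub_left, real_inner_self_eq_norm_sq]
    rw [hn, hexp] at hnn
    linarith
  have hker : ∀ z : Sph 2, θ z = 0 → inner ℝ n z.1 = 0 := by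
    intro z hz
    have h1 : orthLI Q z.1 = z.1 := congrArg Subtype.val (hfix z hz)
    have h2 : inner ℝ y.1 z.1 = inner ℝ x.1 z.1 := by
      conv_lhs => rw [← h1]
      exact (orthLI Q).inner_map_map x.1 z.1
    rw [hn, inner_sub_left, h2, sub_self]
  obtain ⟨s, hs, h1⟩ := hθ.exists_sign_of_isPreconnected (isPreconnected_hemisphere n)
    fun z hz h => by
      have h0 := hker z h
      simp only [mem_ofPred_eq] at hz
      exact hz.ne' h0
  obtain ⟨t, ht, h2⟩ := hθ.exists_sign_of_isPreconnected (isPreconnected_hemisphere (-n))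
    fun z hz h => by
      have h0 := hker z h
      simp only [mem_ofPred_eq, inner_neg_left, h0] at hz
      simp at hz
  have hst : t = s := by rw [← h2 x hnx, ← hQ x, ← h1 y hny]
  -- Both open hemispheres carry the sign s, so -s can only occur on the great circle between them.
  obtain ⟨z, hz⟩ := hθ.exists_eq (-s)
  have hss : ∀ s : SignType, s ≠ 0 → s ≠ -s ∧ -s ≠ 0 := by decide
  have hz0 : inner ℝ n z.1 = 0 := by
    rcases lt_trichotomy (inner ℝ n z.1) 0 with h | h | h
    · have := h2 z (show 0 < inner ℝ (-n) z.1 by rw [inner_neg_left]; linarith)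
      rw [hst, hz] at this
      exact absurd this.symm (hss s hs).1
    · exact h
    · have := h1 z h
      rw [hz] at this
      exact absurd this.symm (hss s hs).1
  have hne : ∀ r : ℝ, z.1 + r • n ≠ 0 := by
    intro r h
    have := congrArg (fun v => inner ℝ v z.1) h
    simp only [inner_add_left, inner_smul_left, real_inner_self_eq_norm_sq, hz0] at this
    simp at this
  -- Pushing z off the great circle towards n enters a hemisphere of sign s at once, whereas the set
  -- where θ = -s is open.
  let c : ℝ → Sph 2 := fun r => ⟨‖z.1 + r • n‖⁻¹ • (z.1 + r • n), by
    rw [mem_sphere_zero_iff_norm, norm_smul, norm_inv, norm_norm,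
      inv_mul_cancel₀ (norm_ne_zero_iff.2 (hne r))]⟩
  have hc : Continuous c := by
    refine Continuous.subtype_mk ?_ _
    have h3 : Continuous fun r : ℝ => z.1 + r • n := by fun_prop
    exact (h3.norm.inv₀ fun r => norm_ne_zero_iff.2 (hne r)).smul h3
  have hc0 : c 0 = z := Subtype.ext (by simp [c])
  have hopen : IsOpen (c ⁻¹' (θ ⁻¹' {-s})) :=
    (hθ.isOpen_preimage (hss s hs).2).preimage hc
  have hmem : (0 : ℝ) ∈ c ⁻¹' (θ ⁻¹' {-s}) := by
    show θ (c 0) = -s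
    rw [hc0, hz]
  obtain ⟨ε, hε, hball⟩ := Metric.isOpen_iff.1 hopen 0 hmem
  have h4 : θ (c (ε / 2)) = -s := hball (by
    rw [Metric.mem_ball, Real.dist_eq, sub_zero, abs_of_pos (by positivity)]; linarith)
  have h5 : θ (c (ε / 2)) = s := by
    refine h1 _ ?_
    show 0 < inner ℝ n (‖z.1 + (ε / 2) • n‖⁻¹ • (z.1 + (ε / 2) • n))
    rw [inner_smul_right, inner_add_right, hz0, inner_smul_right, real_inner_self_eq_norm_sq]
    have := norm_pos_iff.2 (hne (ε / 2))
    positivity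
  rw [h5] at h4
  exact (hss s hs).1 h4

/-! ### Symmetries of the circle -/

theorem sph_one_sq (x : Sph 1) : x.1 0 ^ 2 + x.1 1 ^ 2 = 1 := by
  have h : ‖x.1‖ ^ 2 = 1 := by simp
  rwa [EuclideanSpace.norm_sq_eq, Fin.sum_univ_two, Real.norm_eq_abs, Real.norm_eq_abs, sq_abs,
    sq_abs] at h

theorem sph_one_ext {x y : Sph 1} (h0 : x.1 0 = y.1 0) (h1 : x.1 1 = y.1 1) : x = y := by
  refine Subtype.ext (PiLp.ext fun i => ?_)
  fin_cases i
  · exact h0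
  · exact h1

/-- The half of the circle that lies on one side of the first coordinate axis. -/
def halfCircle (σ : ℝ) (hσ : σ ^ 2 = 1) (t : ℝ) : Sph 1 :=
  ⟨!₂[Real.cos t, σ * Real.sin t], by
    simp [EuclideanSpace.norm_eq, Fin.sum_univ_two, mul_pow, hσ]⟩

theorem continuous_halfCircle (σ : ℝ) (hσ : σ ^ 2 = 1) : Continuous (halfCircle σ hσ) := by
  refine Continuous.subtype_mk ((PiLp.continuous_toLp 2 _).comp (continuous_pi fun i => ?_)) _
  fin_cases i
  · exact Real.continuous_cos
  · exact continuous_const.mul Real.continuous_sin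

theorem halfCircle_arccos {σ : ℝ} (hσ : σ ^ 2 = 1) {x : Sph 1} (hx : x.1 1 = σ * |x.1 1|) :
    halfCircle σ hσ (Real.arccos (x.1 0)) = x := by
  have h := sph_one_sq x
  have h1 : -1 ≤ x.1 0 := by nlinarith [sq_nonneg (x.1 1)]
  have h2 : x.1 0 ≤ 1 := by nlinarith [sq_nonneg (x.1 1)]
  refine sph_one_ext ?_ ?_
  · simp [halfCircle, Real.cos_arccos h1 h2]
  · have h3 : 1 - x.1 0 ^ 2 = x.1 1 ^ 2 := by linarith
    simp [halfCircle, Real.sin_arccos, h3, Real.sqrt_sq_eq_abs, ← hx]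

/-- The iterates of an increasing self-map of an interval converge. -/
theorem exists_tendsto_iterate {f : ℝ → ℝ} {a b : ℝ} (hmaps : ∀ t ∈ Icc a b, f t ∈ Icc a b)
    (hmono : MonotoneOn f (Icc a b)) {t : ℝ} (ht : t ∈ Icc a b) :
    ∃ T, Filter.Tendsto (fun n => f^[n] t) Filter.atTop (𝓝 T) := by
  have hmem : ∀ n, f^[n] t ∈ Icc a b := by
    intro n
    induction n with
    | zero => exact ht
    | succ n ih => rw [Function.iterate_succ_apply']; exact hmaps _ ih
  rcases le_total t (f t) with h | h
  · have hm : Monotone fun n => f^[n] t := monotone_nat_of_le_succ fun n => by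
      induction n with
      | zero => exact h
      | succ n ih =>
        rw [Function.iterate_succ_apply', Function.iterate_succ_apply' f (n + 1)]
        exact hmono (hmem n) (hmem (n + 1)) ih
    exact ⟨_, tendsto_atTop_ciSup hm ⟨b, by rintro _ ⟨n, rfl⟩; exact (hmem n).2⟩⟩
  · have hm : Antitone fun n => f^[n] t := antitone_nat_of_succ_le fun n => by
      induction n with
      | zero => exact h
      | succ n ih =>
        have h' := hmono (hmem (n + 1)) (hmem n) ih
        rwa [← Function.iterate_succ_apply' f, ← Function.iterate_succ_apply' f] at h'
    exact ⟨_, tendsto_atTop_ciInf hm ⟨a, by rintro _ ⟨n, rfl⟩; exact (hmem n).1⟩⟩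

/-- A self-embedding of the circle that preserves the two sides of the first coordinate axis,
fixes the points of that axis, and is conjugate to a restriction of an isometry is the identity. -/
theorem circle_symmetry_trivial {M : Type*} [MetricSpace M] {χ : Sph 1 → M} (hχ : Continuous χ)
    (hχi : Function.Injective χ) {q : M → M} (hq : Isometry q) {g : Sph 1 → Sph 1}
    (hg : Continuous g) (hgq : ∀ x, χ (g x) = q (χ x)) (hside : ∀ x, aimLast 1 (g x) = aimLast 1 x)
    (hfix : ∀ x, aimLast 1 x = 0 → g x = x) (x : Sph 1) : g x = x := by
  have hgi : Function.Injective g := fun x y h => hχi (hq.injective (by rw [← hgq, ← hgq, h]))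
  have hside' : ∀ x, SignType.sign ((g x).1 1) = SignType.sign (x.1 1) := hside
  obtain ⟨σ, hσ, hx⟩ : ∃ σ : ℝ, σ ^ 2 = 1 ∧ x.1 1 = σ * |x.1 1| := by
    rcases le_total 0 (x.1 1) with h | h
    · exact ⟨1, by norm_num, by rw [abs_of_nonneg h, one_mul]⟩
    · exact ⟨-1, by norm_num, by rw [abs_of_nonpos h]; ring⟩
  have hσ' : σ = 1 ∨ σ = -1 := by
    simpa using hσ
  set c := halfCircle σ hσ with hc
  have hcc : Continuous c := continuous_halfCircle σ hσ
  -- This is `g` on the half circle through x, in the angle coordinate on [0, π]. It is continuous,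
  -- injective and fixes both endpoints, hence increasing.
  let f : ℝ → ℝ := fun t => Real.arccos ((g (c t)).1 0)
  have hf : Continuous f := by
    refine Real.continuous_arccos.comp ?_
    have : Continuous fun y : Sph 1 => y.1 0 := by fun_prop
    exact this.comp (hg.comp hcc)
  have hmaps : ∀ t, f t ∈ Icc 0 Real.pi := fun t => ⟨Real.arccos_nonneg _, Real.arccos_le_pi _⟩
  have hcf : ∀ t ∈ Icc 0 Real.pi, c (f t) = g (c t) := by
    intro t ht
    refine halfCircle_arccos hσ ?_
    have hs := hside' (c t)
    have hct : (c t).1 1 = σ * Real.sin t := by simp [hc, halfCircle]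
    have hsin : 0 ≤ Real.sin t := Real.sin_nonneg_of_mem_Icc ht
    rw [hct] at hs
    rcases hσ' with h | h
    · have : 0 ≤ (g (c t)).1 1 := by
        rw [← sign_nonneg_iff, hs, sign_nonneg_iff, h, one_mul]; exact hsin
      rw [abs_of_nonneg this, h, one_mul]
    · have : (g (c t)).1 1 ≤ 0 := by
        rw [← sign_nonpos_iff, hs, sign_nonpos_iff, h]; linarith
      rw [abs_of_nonpos this, h]; ring
  have hinj : InjOn f (Icc 0 Real.pi) := by
    intro s hs t ht hst
    have h1 : g (c s) = g (c t) := by rw [← hcf s hs, ← hcf t ht, hst]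
    have h2 := congrArg (fun y : Sph 1 => y.1 0) (hgi h1)
    exact Real.injOn_cos hs ht (by simpa [hc, halfCircle] using h2)
  have hend : ∀ t, Real.sin t = 0 → t ∈ Icc 0 Real.pi → f t = t := by
    intro t h0 ht
    have h1 : g (c t) = c t := hfix _ (by
      show SignType.sign ((c t).1 1) = 0
      simp [hc, halfCircle, h0])
    show Real.arccos ((g (c t)).1 0) = t
    rw [h1]
    simpa [hc, halfCircle] using Real.arccos_cos ht.1 ht.2
  have hpi := Real.pi_pos.le
  have hmono : StrictMonoOn f (Icc 0 Real.pi) := by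
    refine ContinuousOn.strictMonoOn_of_injOn_Icc hpi ?_ hf.continuousOn hinj
    rw [hend 0 Real.sin_zero ⟨le_rfl, hpi⟩, hend _ Real.sin_pi ⟨hpi, le_rfl⟩]
    exact hpi
  set t := Real.arccos (x.1 0) with ht
  have htm : t ∈ Icc 0 Real.pi := ⟨Real.arccos_nonneg _, Real.arccos_le_pi _⟩
  have hct : c t = x := halfCircle_arccos hσ hx
  obtain ⟨T, hT⟩ := exists_tendsto_iterate (fun t _ => hmaps t) hmono.monotoneOn htm
  have hiter : ∀ n, f^[n] t ∈ Icc 0 Real.pi ∧ c (f^[n] t) = g^[n] x := by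
    intro n
    induction n with
    | zero => exact ⟨htm, hct⟩
    | succ n ih =>
      rw [Function.iterate_succ_apply', Function.iterate_succ_apply']
      exact ⟨hmaps _, by rw [hcf _ ih.1, ih.2]⟩
  have hlim : Filter.Tendsto (fun n => g^[n] x) Filter.atTop (𝓝 (c T)) := by
    have := (hcc.tendsto T).comp hT
    exact this.congr fun n => (hiter n).2
  have hgT : g (c T) = c T := by
    refine tendsto_nhds_unique ((hg.tendsto _).comp hlim) ?_
    have := hlim.comp (Filter.tendsto_add_atTop_nat 1)
    refine this.congr fun n => ?_
    simp only [Function.comp_apply, Function.iterate_succ_apply']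
  -- The limit c(T) of the iterates is fixed by `g`, and the isometry `q` keeps their distance to
  -- it, measured in `M`, constant. As this distance tends to 0, it vanishes already for x.
  have hdist : ∀ n, dist (χ (g^[n] x)) (χ (c T)) = dist (χ x) (χ (c T)) := by
    intro n
    induction n with
    | zero => rfl
    | succ n ih =>
      rw [Function.iterate_succ_apply', ← ih, hgq]
      conv_lhs => rw [← hgT, hgq]
      exact hq.dist_eq _ _
  have h0 : dist (χ x) (χ (c T)) = 0 := by
    have h1 := tendsto_iff_dist_tendsto_zero.1 ((hχ.tendsto _).comp hlim)
    simp only [Function.comp_apply, hdist] at h1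
    exact tendsto_nhds_unique tendsto_const_nhds h1
  have hxT : x = c T := hχi (dist_eq_zero.1 h0)
  rw [hxT, hgT]

/-! ### Spanning arrangements have no orthogonal symmetries -/

theorem sph_zero_apply (x : Sph 0) : x.1 0 = 1 ∨ x.1 0 = -1 := by
  have h : ‖x.1‖ ^ 2 = 1 := by simp
  rw [EuclideanSpace.norm_sq_eq, Fin.sum_univ_one, Real.norm_eq_abs, sq_abs] at h
  simpa using h

theorem aimLast_zero_ne_zero (x : Sph 0) : aimLast 0 x ≠ 0 := by
  intro h
  have h0 : x.1 0 = 0 := sign_eq_zero_iff.1 h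
  rcases sph_zero_apply x with hx | hx <;> rw [h0] at hx <;> norm_num at hx

theorem aimLast_zero_injective : Function.Injective (aimLast 0) := by
  intro x y h
  have h' : SignType.sign (x.1 0) = SignType.sign (y.1 0) := h
  have key : x.1 0 = y.1 0 := by
    rcases sph_zero_apply x with hx | hx <;> rcases sph_zero_apply y with hy | hy
    · rw [hx, hy]
    · rw [hx, hy] at h'; simp at h'
    · rw [hx, hy] at h'; simp at h'
    · rw [hx, hy]
  refine Subtype.ext (PiLp.ext fun i => ?_)
  fin_cases i
  exact key

theorem exists_equator_triple : ∃ x y z : Equator, x ≠ y ∧ y ≠ z ∧ x ≠ z := by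
  have h0 : ∀ v : Sph 2, v.1 2 = 0 → aimLast 2 v = 0 := fun v => aimLast_eq_zero_iff.2
  have hne : ∀ {u v : Sph 2}, u.1 0 ≠ v.1 0 → u ≠ v := fun h h' => h (by rw [h'])
  refine ⟨⟨axis 0, h0 _ (by simp [axis_apply])⟩, ⟨axis 1, h0 _ (by simp [axis_apply])⟩,
    ⟨-axis 0, h0 _ (by simp [axis_apply])⟩, ?_, ?_, ?_⟩ <;>
  refine fun h => hne ?_ (congrArg Subtype.val h) <;> norm_num [axis_apply]

/-- A spanning arrangement contains a pseudosphere whose kernel is a circle, another one that cuts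
this circle in two points, and a third one that separates these two points. -/
theorem exists_flag {ι : Type*} {θ : ι → Sph 2 → SignType} (hθ : IsArrangement 2 θ)
    (hs : IsSpanning θ) : ∃ (i j k : ι) (χ : Sph 1 → Sph 2), Continuous χ ∧ IsInducing χ ∧
      Function.Injective χ ∧ range χ = θ i ⁻¹' {0} ∧ θ i ≠ 0 ∧
      (θ j ∘ χ = aimLast 1 ∨ -(θ j ∘ χ) = aimLast 1) ∧
      ∀ x y, aimLast 1 x = 0 → aimLast 1 y = 0 → θ k (χ x) = θ k (χ y) → x = y := by
  have hspan : ∀ x, ∃ i, θ i x ≠ 0 := by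
    intro x
    by_contra! h
    have : x ∈ commonKer θ univ := fun i _ => h i
    rw [show commonKer θ univ = ∅ from hs] at this
    exact this
  have hker : ∀ {X κ : Type _} (η : κ → X → SignType) (i : κ) (x : X),
      x ∈ commonKer η {i} ↔ η i x = 0 := by
    intro X κ η i x
    exact ⟨fun h => h i rfl, fun h j hj => by rw [show j = i from hj]; exact h⟩
  rw [IsArrangement] at hθ
  obtain ⟨h1, h2⟩ := hθ
  obtain ⟨i, hi⟩ := hspan (axis 0)
  have hi0 : θ i ≠ 0 := fun h => hi (by rw [h]; rfl)
  have hpar : ∃ φ : Sph 2 ≃ₜ Sph 2, ∀ x, aimLast 2 x = 0 ↔ θ i (φ x) = 0 := by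
    rcases h1 i with h | ⟨φ, -, h⟩ | ⟨φ, -, h⟩
    · exact absurd h hi0
    · exact ⟨φ, fun x => by rw [← h]; rfl⟩
    · refine ⟨φ, fun x => ?_⟩
      rw [← h]
      show -θ i (φ x) = 0 ↔ _
      generalize θ i (φ x) = s
      revert s; decide
  obtain ⟨φ₀, hφ₀⟩ := hpar
  rcases h2 {i} with h | h | ⟨e, he, φ, hφ⟩
  · exact absurd ((hker θ i _).2 ((hφ₀ _).1 east.2)) (by rw [h]; exact id)
  · exact absurd ((hker θ i _).1 (h ▸ mem_univ (axis 0))) hi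
  -- The kernel contains a homeomorphic image of the equator, hence three distinct points, whereas
  -- S⁰ has only two.
  have he1 : e = 1 := by
    by_contra hne
    obtain rfl : e = 0 := by omega
    obtain ⟨x, y, z, hxy, hyz, hxz⟩ := exists_equator_triple
    let m : Equator → SignType := fun x =>
      aimLast 0 (φ.symm ⟨φ₀ x.1, (hker θ i _).2 ((hφ₀ _).1 x.2)⟩)
    have hm : Function.Injective m := by
      intro x y h
      have := φ.symm.injective (aimLast_zero_injective h)
      exact Subtype.ext (φ₀.injective (congrArg Subtype.val this))
    have hm0 : ∀ x, m x ≠ 0 := fun x => aimLast_zero_ne_zero _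
    have h3 : ∀ a b c : SignType, a ≠ 0 → b ≠ 0 → c ≠ 0 → a = b ∨ b = c ∨ a = c := by decide
    rcases h3 (m x) (m y) (m z) (hm0 x) (hm0 y) (hm0 z) with h | h | h
    · exact hxy (hm h)
    · exact hyz (hm h)
    · exact hxz (hm h)
  subst he1
  rw [IsArrangement] at hφ
  obtain ⟨g1, g2⟩ := hφ
  let p : Sph 1 := ⟨EuclideanSpace.single 0 1, by simp⟩
  have hp : aimLast 1 p = 0 := by simp [aimLast, p]
  obtain ⟨j, hj⟩ := hspan (φ p).1
  have hpar : ∃ ψ : Sph 1 ≃ₜ Sph 1, (θ j ∘ (fun x => (φ x).1) ∘ ψ = aimLast 1 ∨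
      -(θ j ∘ (fun x => (φ x).1) ∘ ψ) = aimLast 1) := by
    rcases g1 j with h | ⟨ψ, -, h⟩ | ⟨ψ, -, h⟩
    · exact absurd (congrFun h p) hj
    · exact ⟨ψ, Or.inl h⟩
    · exact ⟨ψ, Or.inr h⟩
  obtain ⟨ψ, hψ⟩ := hpar
  have hψ0 : ∀ x, aimLast 1 x = 0 → θ j (φ (ψ x)) = 0 := by
    intro x hx
    rcases hψ with h | h
    · exact (congrFun h x).trans hx
    · have h4 : -θ j (φ (ψ x)) = 0 := (congrFun h x).trans hx
      revert h4
      generalize θ j (φ (ψ x)) = s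
      revert s; decide
  have hk : ∃ k, ∀ x y, aimLast 1 x = 0 → aimLast 1 y = 0 → θ k (φ (ψ x)) = θ k (φ (ψ y)) →
      x = y := by
    -- The zero set of member j on the circle is neither empty nor everything, so it is a copy of
    -- S⁰. A member nonzero at one of its two points restricts to an orientation of S⁰ and so
    -- separates them.
    rcases g2 {j} with h | h | ⟨e, he, ω, hω⟩
    · exact absurd ((hker (fun i x => θ i (φ x)) j (ψ p)).2 (hψ0 p hp)) (by rw [h]; exact id)
    · exact absurd ((hker (fun i x => θ i (φ x)) j p).1 (h ▸ mem_univ p)) hj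
    obtain rfl : e = 0 := by omega
    let o : Sph 0 := ⟨EuclideanSpace.single 0 1, by simp⟩
    obtain ⟨k, hk⟩ := hspan (φ (ω o).1).1
    refine ⟨k, fun x y hx hy hxy => ?_⟩
    have hinj : Function.Injective fun z : Sph 0 => θ k (φ (ω z).1).1 := by
      rw [IsArrangement] at hω
      rcases hω.1 k with h | ⟨ρ, -, h⟩ | ⟨ρ, -, h⟩
      · exact absurd (congrFun h o) hk
      · intro a b hab
        refine ρ.symm.injective (aimLast_zero_injective ?_)
        rw [← h]
        simpa using hab
      · intro a b hab
        refine ρ.symm.injective (aimLast_zero_injective ?_)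
        rw [← h]
        simpa using hab
    have h5 := hinj (a₁ := ω.symm ⟨ψ x, (hker (fun i x => θ i (φ x)) j (ψ x)).2 (hψ0 x hx)⟩)
      (a₂ := ω.symm ⟨ψ y, (hker (fun i x => θ i (φ x)) j (ψ y)).2 (hψ0 y hy)⟩)
      (by simpa using hxy)
    exact ψ.injective (congrArg Subtype.val (ω.symm.injective h5))
  obtain ⟨k, hk⟩ := hk
  refine ⟨i, j, k, fun x => (φ (ψ x)).1, ?_, ?_, ?_, ?_, hi0, hψ, hk⟩
  · exact continuous_subtype_val.comp (φ.continuous.comp ψ.continuous)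
  · exact IsInducing.subtypeVal.comp (φ.isInducing.comp ψ.isInducing)
  · exact Subtype.val_injective.comp (φ.injective.comp ψ.injective)
  · ext y
    constructor
    · rintro ⟨x, rfl⟩
      exact (hker θ i _).1 (φ (ψ x)).2
    · intro hy
      refine ⟨ψ.symm (φ.symm ⟨y, (hker θ i y).2 hy⟩), ?_⟩
      simp

/-- In a spanning weighted arrangement there are three members that have no common orthogonal
symmetry. -/
theorem IsSpanningArr.exists_triple {ι : Type*} {A : ι → WPS} (hA : IsSpanningArr A) :
    ∃ i : Fin 3 → ι, ∀ Q : O3, (∀ m, op Q • A (i m) = A (i m)) → Q = 1 := by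
  obtain ⟨i, j, k, χ, hχ, hχ', hχi, hrange, hi, hj, hk⟩ := exists_flag hA.1 hA.2
  refine ⟨![i, j, k], fun Q hQ => ?_⟩
  have hinv : ∀ m x, (A (![i, j, k] m)).aim (orthHomeo Q x) = (A (![i, j, k] m)).aim x :=
    fun m x => congrFun (congrArg WPS.aim (hQ m)) x
  have hQi : ∀ x, (A i).aim (orthHomeo Q x) = (A i).aim x := hinv 0
  have hQj : ∀ x, (A j).aim (orthHomeo Q x) = (A j).aim x := hinv 1
  have hQk : ∀ x, (A k).aim (orthHomeo Q x) = (A k).aim x := hinv 2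
  have hps : IsPseudosphere (A i).aim := by
    rcases (A i).valid with ⟨-, h⟩ | ⟨-, h⟩
    · exact h
    · exact absurd h hi
  -- Q preserves the zero set of member i, so it induces a self-map `g` of the circle that
  -- parameterizes this set.
  have hg : ∀ x, ∃ y, χ y = orthHomeo Q (χ x) := by
    intro x
    have h1 : χ x ∈ (A i).aim ⁻¹' {0} := hrange ▸ mem_range_self x
    have h2 : orthHomeo Q (χ x) ∈ range χ := by
      rw [hrange]
      exact (hQi _).trans h1
    exact h2
  choose g hg using hg
  have hgc : Continuous g := by
    rw [hχ'.continuous_iff]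
    have : χ ∘ g = orthHomeo Q ∘ χ := funext hg
    rw [this]
    exact (orthHomeo Q).continuous.comp hχ
  have hside : ∀ x, aimLast 1 (g x) = aimLast 1 x := by
    intro x
    rcases hj with h | h
    · rw [← h]
      show (A j).aim (χ (g x)) = (A j).aim (χ x)
      rw [hg, hQj]
    · rw [← h]
      show -(A j).aim (χ (g x)) = -(A j).aim (χ x)
      rw [hg, hQj]
  have hiso : Isometry (orthHomeo Q) := fun x y => (orthLI Q).isometry x.1 y.1
  -- The map `g` permutes the two zeros of member j, and member k, which is invariant and separates
  -- them, forces both to be fixed.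
  have hid := circle_symmetry_trivial hχ hχi hiso hgc hg hside fun x hx =>
    hk _ _ ((hside x).trans hx) hx (by rw [hg]; exact hQk _)
  refine hps.orth_eq_one hQi fun y hy => ?_
  obtain ⟨x, rfl⟩ : y ∈ range χ := by rw [hrange]; exact hy
  rw [← hg, hid]

/-! ### Orthonormalization of matrices -/

section GramSchmidt
open InnerProductSpace

/-- The process uses only inner products and linear combinations. -/
theorem gramSchmidt_map_isometry {E : Type*} [NormedAddCommGroup E] [InnerProductSpace ℝ E]
    {ι : Type*} [LinearOrder ι] [LocallyFiniteOrderBot ι] [WellFoundedLT ι]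
    (L : E ≃ₗᵢ[ℝ] E) (f : ι → E) (n : ι) :
    gramSchmidt ℝ (fun i => L (f i)) n = L (gramSchmidt ℝ f n) := by
  induction n using WellFoundedLT.induction with
  | ind n ih =>
    rw [gramSchmidt_def, gramSchmidt_def, map_sub, map_sum]
    congr 1
    refine Finset.sum_congr rfl fun i hi => ?_
    rw [ih i (Finset.mem_Iio.1 hi), Submodule.starProjection_singleton,
      Submodule.starProjection_singleton, L.inner_map_map, L.norm_map, map_smul]

theorem continuousOn_gramSchmidt {E : Type*} [NormedAddCommGroup E] [InnerProductSpace ℝ E]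
    {ι : Type*} [LinearOrder ι] [LocallyFiniteOrderBot ι] [WellFoundedLT ι]
    {X : Type*} [TopologicalSpace X] {f : X → ι → E} {s : Set X}
    (hf : ∀ i, ContinuousOn (fun x => f x i) s) (hs : ∀ x ∈ s, LinearIndependent ℝ (f x)) (n : ι) :
    ContinuousOn (fun x => gramSchmidt ℝ (f x) n) s := by
  induction n using WellFoundedLT.induction with
  | ind n ih =>
    have hdef : (fun x => gramSchmidt ℝ (f x) n) = fun x => f x n - ∑ i ∈ Finset.Iio n,
        (inner ℝ (gramSchmidt ℝ (f x) i) (f x n) / ‖gramSchmidt ℝ (f x) i‖ ^ 2) •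
          gramSchmidt ℝ (f x) i := by
      funext x
      rw [gramSchmidt_def]
      simp only [Submodule.starProjection_singleton]
      rfl
    rw [hdef]
    refine (hf n).sub (continuousOn_finsetSum _ fun i hi => ?_)
    have h := ih i (Finset.mem_Iio.1 hi)
    refine ContinuousOn.fun_smul (ContinuousOn.div (h.inner (𝕜 := ℝ) (hf n)) (h.norm.pow 2)
      fun x hx => ?_) h
    exact pow_ne_zero 2 (norm_ne_zero_iff.2 (gramSchmidt_ne_zero i (hs x hx)))

/-- The columns of a matrix as vectors of `ℝ³`. -/
def colVec (M : Matrix (Fin 3) (Fin 3) ℝ) (j : Fin 3) : E3 := WithLp.toLp 2 (fun i => M i j)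

theorem linearIndependent_colVec {M : Matrix (Fin 3) (Fin 3) ℝ} (hM : M.det ≠ 0) :
    LinearIndependent ℝ (colVec M) := by
  have h : LinearIndependent ℝ M.col :=
    Matrix.linearIndependent_cols_iff_isUnit.2 ((Matrix.isUnit_iff_isUnit_det _).2 hM.isUnit)
  exact h.map' (WithLp.linearEquiv 2 ℝ (Fin 3 → ℝ)).symm.toLinearMap (LinearEquiv.ker _)

/-- The matrix obtained by the Gram-Schmidt process from the columns of `M`. -/
def orthonormalizeMatrix (M : Matrix (Fin 3) (Fin 3) ℝ) : Matrix (Fin 3) (Fin 3) ℝ :=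
  Matrix.of fun i j => gramSchmidtNormed ℝ (colVec M) j i

theorem orthonormalizeMatrix_mem {M : Matrix (Fin 3) (Fin 3) ℝ} (hM : M.det ≠ 0) :
    orthonormalizeMatrix M ∈ Matrix.orthogonalGroup (Fin 3) ℝ := by
  rw [Matrix.mem_orthogonalGroup_iff']
  ext i j
  have h := orthonormal_iff_ite.1 (gramSchmidtNormed_orthonormal (linearIndependent_colVec hM)) i j
  rw [inner_E3] at h
  rw [Matrix.mul_apply, Matrix.one_apply, ← h, Fin.sum_univ_three]
  rfl

open Classical in
/-- The orthogonal matrix obtained by the Gram-Schmidt process from an invertible matrix. -/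
def orthonormalize (M : Matrix (Fin 3) (Fin 3) ℝ) : O3 :=
  -- The value 1 at singular matrices is a filler; equivariance and continuity are claimed only
  -- where the determinant is nonzero.
  if h : M.det ≠ 0 then ⟨orthonormalizeMatrix M, orthonormalizeMatrix_mem h⟩ else 1

theorem coe_orthonormalize {M : Matrix (Fin 3) (Fin 3) ℝ} (hM : M.det ≠ 0) :
    (orthonormalize M).1 = orthonormalizeMatrix M := by
  rw [orthonormalize, dif_pos hM]

/-- Left multiplication by P applies one isometry to all columns, and Gram-Schmidt commutes with
isometries. -/
theorem orthonormalize_mul (P : O3) {M : Matrix (Fin 3) (Fin 3) ℝ} (hM : M.det ≠ 0) :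
    orthonormalize (P.1 * M) = P * orthonormalize M := by
  have hP : P.1.det ≠ 0 := by
    rcases isPos_sphHomeo (orthLI P) with ⟨hd, -⟩ | ⟨hd, -⟩ <;> rw [det_orthLI] at hd <;>
      rw [hd] <;> norm_num
  have hPM : (P.1 * M).det ≠ 0 := by
    rw [Matrix.det_mul]
    exact mul_ne_zero hP hM
  refine Subtype.ext ?_
  rw [coe_orthonormalize hPM, Submonoid.coe_mul, coe_orthonormalize hM]
  have hcol : colVec (P.1 * M) = fun j => orthLI P (colVec M j) := by
    funext j
    rfl
  ext i j
  have h : gramSchmidtNormed ℝ (colVec (P.1 * M)) j =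
      orthLI P (gramSchmidtNormed ℝ (colVec M) j) := by
    rw [gramSchmidtNormed, gramSchmidtNormed, hcol, gramSchmidt_map_isometry,
      LinearIsometryEquiv.norm_map, map_smul]
  show gramSchmidtNormed ℝ (colVec (P.1 * M)) j i = _
  rw [h]
  rfl

theorem continuousOn_orthonormalize :
    ContinuousOn orthonormalize {M : Matrix (Fin 3) (Fin 3) ℝ | M.det ≠ 0} := by
  rw [IsInducing.subtypeVal.continuousOn_iff]
  have h : ContinuousOn orthonormalizeMatrix {M : Matrix (Fin 3) (Fin 3) ℝ | M.det ≠ 0} := by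
    have hcol : ∀ j, Continuous fun M : Matrix (Fin 3) (Fin 3) ℝ => colVec M j := fun j =>
      (PiLp.continuous_toLp 2 _).comp (continuous_pi fun i => continuous_id.matrix_elem i j)
    have hgs : ∀ j, ContinuousOn (fun M : Matrix (Fin 3) (Fin 3) ℝ =>
        gramSchmidtNormed ℝ (colVec M) j) {M | M.det ≠ 0} := by
      intro j
      have h1 := continuousOn_gramSchmidt (f := colVec) (s := {M | M.det ≠ 0})
        (fun i => (hcol i).continuousOn) (fun M hM => linearIndependent_colVec hM) j
      refine ContinuousOn.fun_smul (ContinuousOn.inv₀ ?_ fun M hM => ?_) h1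
      · exact h1.norm
      · exact_mod_cast norm_ne_zero_iff.2
          (gramSchmidt_ne_zero j (linearIndependent_colVec hM))
    refine continuousOn_pi.2 fun i => continuousOn_pi.2 fun j => ?_
    exact (show Continuous fun v : E3 => v i by fun_prop).comp_continuousOn
      (hgs j)
  exact h.congr fun M hM => coe_orthonormalize hM

end GramSchmidt

/-! ### Equivariant maps to the orthogonal group -/

section Average
open MeasureTheory

instance : MeasurableSpace O3 := borel O3

instance : BorelSpace O3 := ⟨rfl⟩

variable {Y : Type*} [TopologicalSpace Y] [MulAction O3ᵐᵒᵖ Y]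

/-- The average over the orthogonal group of the translates of a function, with matrix weights
that make it equivariant. -/
def averageMatrix (h : Y → ℝ) (y : Y) : Matrix (Fin 3) (Fin 3) ℝ :=
  Matrix.of fun i j => ∫ Q : O3, h (op Q • y) * Q.1 i j ∂Measure.haar

theorem continuous_average_integrand (hact : Continuous fun p : Y × O3 => op p.2 • p.1)
    {h : Y → ℝ} (hh : Continuous h) (y : Y) (i j : Fin 3) :
    Continuous fun Q : O3 => h (op Q • y) * Q.1 i j :=
  (hh.comp (hact.comp (Continuous.prodMk_right y))).mul
    (continuous_subtype_val.matrix_elem i j)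

theorem integrable_of_continuous_O3 {f : O3 → ℝ} (hf : Continuous f) :
    Integrable f (Measure.haar : Measure O3) :=
  hf.integrable_of_hasCompactSupport (HasCompactSupport.of_compactSpace f)

/-- Substitute Q' = PQ in the integral: Haar measure is left invariant, and the weight Q becomes
P⁻¹Q'. -/
theorem averageMatrix_smul (hact : Continuous fun p : Y × O3 => op p.2 • p.1)
    {h : Y → ℝ} (hh : Continuous h) (P : O3) (y : Y) :
    averageMatrix h (op P • y) = (P⁻¹).1 * averageMatrix h y := by
  ext i j
  have h1 : ∀ Q : O3, h (op Q • op P • y) * Q.1 i j =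
      (fun Q' : O3 => h (op Q' • y) * (P⁻¹ * Q').1 i j) (P * Q) := by
    intro Q
    simp only [smul_smul, ← op_mul, inv_mul_cancel_left]
  show ∫ Q : O3, h (op Q • op P • y) * Q.1 i j ∂Measure.haar = _
  simp only [h1]
  rw [integral_mul_left_eq_self (fun Q' : O3 => h (op Q' • y) * (P⁻¹ * Q').1 i j) P,
    Matrix.mul_apply]
  simp only [averageMatrix, Matrix.of_apply, Submonoid.coe_mul, Matrix.mul_apply, Finset.mul_sum]
  rw [integral_finsetSum]
  · refine Finset.sum_congr rfl fun k _ => ?_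
    rw [← integral_const_mul]
    congr 1
    funext Q
    ring
  · intro k _
    have := (integrable_of_continuous_O3
      (continuous_average_integrand hact hh y k j)).const_mul ((P⁻¹).1 i k)
    refine this.congr (Filter.Eventually.of_forall fun Q => ?_)
    show _ * (_ * _) = _ * (_ * _)
    ring

/-- Dominated convergence, since entries of orthogonal matrices are bounded by 1; first countability
reduces continuity to sequences. -/
theorem continuous_averageMatrix [FirstCountableTopology Y]
    (hact : Continuous fun p : Y × O3 => op p.2 • p.1)
    {h : Y → ℝ} (hh : Continuous h) {C : ℝ} (hC : ∀ y, |h y| ≤ C) :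
    Continuous (averageMatrix h) := by
  refine continuous_matrix fun i j => ?_
  refine continuous_of_dominated (bound := fun _ => C) (fun y => ?_) (fun y => ?_)
    (integrable_const C) ?_
  · exact (continuous_average_integrand hact hh y i j).aestronglyMeasurable
  · refine Filter.Eventually.of_forall fun Q => ?_
    have h1 : ‖Q.1 i j‖ ≤ 1 := entry_norm_bound_of_unitary Q.2 i j
    rw [norm_mul, Real.norm_eq_abs]
    exact (mul_le_of_le_one_right (abs_nonneg _) h1).trans (hC _)
  · refine Filter.Eventually.of_forall fun Q => ?_
    exact (hh.comp (hact.comp (Continuous.prodMk_left Q))).mul continuous_const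

/-- The average of a bump function with small support on the orbit is invertible. -/
theorem det_averageMatrix_ne_zero (hact : Continuous fun p : Y × O3 => op p.2 • p.1)
    {h : Y → ℝ} (hh : Continuous h) (h0 : ∀ y, 0 ≤ h y) {y : Y} (hy : h y ≠ 0)
    (hsupp : ∀ Q : O3, h (op Q • y) ≠ 0 → ∀ v : Fin 3 → ℝ, v ≠ 0 → 0 < v ⬝ᵥ Q.1.mulVec v) :
    (averageMatrix h y).det ≠ 0 := by
  intro hdet
  obtain ⟨v, hv, hMv⟩ := Matrix.exists_mulVec_eq_zero_iff.2 hdet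
  have hcont : Continuous fun Q : O3 => h (op Q • y) * v ⬝ᵥ Q.1.mulVec v :=
    (hh.comp (hact.comp (Continuous.prodMk_right y))).mul
      (continuous_const.dotProduct (continuous_subtype_val.matrix_mulVec continuous_const))
  -- For v in the kernel of the average, vᵀMv = 0 would be the integral of a nonnegative continuous
  -- function that is positive at Q = 1.
  have hpos : 0 < ∫ Q : O3, h (op Q • y) * v ⬝ᵥ Q.1.mulVec v ∂Measure.haar := by
    refine hcont.integral_pos_of_hasCompactSupport_nonneg_nonzero
      (HasCompactSupport.of_compactSpace _) (fun Q => ?_) (x := 1) ?_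
    · by_cases hQ : h (op Q • y) = 0
      · simp [hQ]
      · exact mul_nonneg (h0 _) (hsupp Q hQ v hv).le
    · have h1 : h (op (1 : O3) • y) ≠ 0 := by rwa [op_one, one_smul]
      exact mul_ne_zero h1 (hsupp 1 h1 v hv).ne'
  have heq : ∫ Q : O3, h (op Q • y) * v ⬝ᵥ Q.1.mulVec v ∂Measure.haar =
      v ⬝ᵥ (averageMatrix h y).mulVec v := by
    have h2 : ∀ Q : O3, h (op Q • y) * v ⬝ᵥ Q.1.mulVec v =
        ∑ i, ∑ j, v i * v j * (h (op Q • y) * Q.1 i j) := by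
      intro Q
      simp only [dotProduct, Matrix.mulVec, Finset.mul_sum]
      refine Finset.sum_congr rfl fun i _ => Finset.sum_congr rfl fun j _ => ?_
      ring
    have hint : ∀ i j, Integrable (fun Q : O3 => v i * v j * (h (op Q • y) * Q.1 i j))
        Measure.haar := fun i j =>
      (integrable_of_continuous_O3 (continuous_average_integrand hact hh y i j)).const_mul _
    simp only [h2]
    rw [integral_finsetSum _ fun i _ => integrable_finsetSum _ fun j _ => hint i j]
    simp only [dotProduct, Matrix.mulVec, Finset.mul_sum]
    refine Finset.sum_congr rfl fun i _ => ?_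
    rw [integral_finsetSum _ fun j _ => hint i j]
    refine Finset.sum_congr rfl fun j _ => ?_
    rw [integral_const_mul]
    simp only [averageMatrix, Matrix.of_apply]
    ring
  rw [heq, hMv, dotProduct_zero] at hpos
  exact lt_irrefl _ hpos

end Average

/-- A local equivariant map to `O(3)` at `y`. -/
def HasLocalFrame {Y : Type*} [TopologicalSpace Y] [MulAction O3ᵐᵒᵖ Y] (y : Y) : Prop :=
  ∃ (W : Set Y) (u : Y → O3), IsOpen W ∧ y ∈ W ∧ (∀ (Q : O3), ∀ z ∈ W, op Q • z ∈ W) ∧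
    ContinuousOn u W ∧ ∀ (Q : O3), ∀ z ∈ W, u (op Q • z) = u z * Q

/-- At Q = 1 the form is ‖v‖². Compactness of the sphere gives positivity on unit vectors for all Q
in one neighborhood, and homogeneity extends it to every v ≠ 0. -/
theorem eventually_dotProduct_mulVec_pos :
    ∀ᶠ Q : O3 in 𝓝 1, ∀ v : Fin 3 → ℝ, v ≠ 0 → 0 < v ⬝ᵥ Q.1.mulVec v := by
  have key : ∀ᶠ Q : O3 in 𝓝 1, ∀ x ∈ (univ : Set (Sph 2)), 0 < inner ℝ x.1 (mv Q x.1) := by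
    refine isCompact_univ.eventually_forall_of_forall_eventually fun x _ => ?_
    have hm : Continuous fun p : O3 × Sph 2 => mv p.1 p.2.1 :=
      continuous_mv.comp (continuous_fst.prodMk (continuous_subtype_val.comp continuous_snd))
    have hc : Continuous fun p : O3 × Sph 2 => (inner ℝ p.2.1 (mv p.1 p.2.1) : ℝ) :=
      (continuous_subtype_val.comp continuous_snd).inner hm
    refine hc.continuousAt.eventually (lt_mem_nhds ?_)
    simp [mv_one]
  filter_upwards [key] with Q hQ v hv
  set w : E3 := WithLp.toLp 2 v with hw
  have hw0 : w ≠ 0 := by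
    intro h
    exact hv (by simpa [hw] using h)
  have hn := norm_pos_iff.2 hw0
  have h1 := hQ ⟨‖w‖⁻¹ • w, by simp [norm_smul, hw0]⟩ trivial
  have h2 : inner ℝ (‖w‖⁻¹ • w) (mv Q (‖w‖⁻¹ • w)) = ‖w‖⁻¹ * (‖w‖⁻¹ * (v ⬝ᵥ Q.1.mulVec v)) := by
    have h3 : mv Q (‖w‖⁻¹ • w) = ‖w‖⁻¹ • mv Q w := (orthLI Q).map_smul _ _
    rw [h3, inner_smul_left, inner_smul_right, EuclideanSpace.inner_eq_star_dotProduct]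
    simp [mv, hw, dotProduct_comm]
  simp only [h2] at h1
  exact pos_of_mul_pos_right (pos_of_mul_pos_right h1 (by positivity)) (by positivity)

/-- A continuous action of `O(3)` on a pseudometric space has local equivariant maps to `O(3)`
at the points whose orbit map is injective up to distance zero. -/
theorem hasLocalFrame_of_edist {Y : Type*} [PseudoEMetricSpace Y] [MulAction O3ᵐᵒᵖ Y]
    (hact : Continuous fun p : Y × O3 => op p.2 • p.1) {y : Y}
    (hfree : ∀ Q : O3, edist (op Q • y) y = 0 → Q = 1) : HasLocalFrame y := by
  obtain ⟨N, hN, hNo, h1N⟩ := eventually_nhds_iff.1 eventually_dotProduct_mulVec_pos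
  have hd : Continuous fun Q : O3 => edist (op Q • y) y :=
    (hact.comp (Continuous.prodMk_right y)).edist continuous_const
  -- On the compact complement of N the distance from y * Q to y attains its minimum, which is
  -- positive by `hfree`. The cap at 1 keeps ε finite.
  obtain ⟨ε, hε, hεt, hεN⟩ : ∃ ε : ℝ≥0∞, 0 < ε ∧ ε ≠ ⊤ ∧ ∀ Q : O3, edist (op Q • y) y < ε → Q ∈ N := by
    rcases (Nᶜ).eq_empty_or_nonempty with h | h
    · exact ⟨1, one_pos, ENNReal.one_ne_top, fun Q _ => by
        rw [compl_empty_iff.1 h]; trivial⟩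
    · obtain ⟨Q₀, hQ₀, hmin⟩ := hNo.isClosed_compl.isCompact.exists_isMinOn h hd.continuousOn
      refine ⟨min 1 (edist (op Q₀ • y) y), lt_min one_pos (pos_iff_ne_zero.2 fun h0 => ?_),
        (min_le_left _ _).trans_lt ENNReal.one_lt_top |>.ne, fun Q hQ => ?_⟩
      · exact hQ₀ (hfree Q₀ h0 ▸ h1N)
      · by_contra hQN
        exact absurd (hmin hQN) (not_le.2 (hQ.trans_le (min_le_right _ _)))
  let h : Y → ℝ := fun z => (ε - edist z y).toReal
  have hle : ∀ z, ε - edist z y ≤ ε := fun z => tsub_le_self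
  have hh : Continuous h := by
    refine ENNReal.continuousOn_toReal.comp_continuous ?_ fun z =>
      ((hle z).trans_lt (lt_top_iff_ne_top.2 hεt)).ne
    exact (ENNReal.continuous_sub_left hεt).comp (continuous_id.edist continuous_const)
  have hh0 : ∀ z, 0 ≤ h z := fun z => ENNReal.toReal_nonneg
  have hC : ∀ z, |h z| ≤ ε.toReal := fun z => by
    rw [abs_of_nonneg (hh0 z)]
    exact ENNReal.toReal_mono hεt (hle z)
  have hy : h y ≠ 0 := by
    simp only [h, edist_self, tsub_zero]
    exact (ENNReal.toReal_pos hε.ne' hεt).ne'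
  have hMc := continuous_averageMatrix hact hh hC
  -- Passing from z to z * Q multiplies the average by Q⁻¹ on the left; inverting the
  -- orthonormalization turns this into right multiplication by Q.
  refine ⟨{z | (averageMatrix h z).det ≠ 0}, fun z => (orthonormalize (averageMatrix h z))⁻¹,
    ?_, ?_, fun Q z hz => ?_, ?_, fun Q z hz => ?_⟩
  · exact isOpen_ne_fun hMc.matrix_det continuous_const
  · refine det_averageMatrix_ne_zero hact hh hh0 hy fun Q hQ => hN Q (hεN Q ?_)
    by_contra hlt
    refine hQ ?_
    simp only [h]
    rw [tsub_eq_zero_of_le (not_lt.1 hlt)]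
    rfl
  · have hz' : (averageMatrix h z).det ≠ 0 := hz
    show (averageMatrix h (op Q • z)).det ≠ 0
    have hQ : (Q⁻¹).1.det ≠ 0 := by
      have h1 : (Q * Q⁻¹).1.det = 1 := by simp
      rw [Submonoid.coe_mul, Matrix.det_mul] at h1
      exact right_ne_zero_of_mul_eq_one h1
    rw [averageMatrix_smul hact hh, Matrix.det_mul]
    exact mul_ne_zero hQ hz'
  · exact (continuousOn_orthonormalize.comp hMc.continuousOn fun z hz => hz).inv
  · simp only
    rw [averageMatrix_smul hact hh, orthonormalize_mul _ hz, mul_inv_rev, inv_inv]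

/-! ### The action on the pseudolinear Stiefel manifolds -/

/-- Frames pull back along continuous equivariant maps, which transfers them from triples to whole
arrangements. -/
theorem HasLocalFrame.comap {X Y : Type*} [TopologicalSpace X] [TopologicalSpace Y]
    [MulAction O3ᵐᵒᵖ X] [MulAction O3ᵐᵒᵖ Y] {F : X → Y} (hF : Continuous F)
    (heq : ∀ (Q : O3) (x : X), F (op Q • x) = op Q • F x) {x : X} (h : HasLocalFrame (F x)) :
    HasLocalFrame x := by
  obtain ⟨W, u, hW, hx, hinv, hu, hequ⟩ := h
  refine ⟨F ⁻¹' W, u ∘ F, hW.preimage hF, hx, fun Q z hz => ?_,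
    hu.comp hF.continuousOn fun z hz => hz, fun Q z hz => ?_⟩
  · rw [mem_preimage, heq]
    exact hinv Q _ hz
  · rw [Function.comp_apply, heq]
    exact hequ Q _ hz

theorem continuous_action_pi {ι : Type*} : Continuous fun p : (ι → WPS) × O3 => op p.2 • p.1 := by
  refine continuous_pi fun i => ?_
  have h : Continuous fun p : (ι → WPS) × O3 => (p.1 i, p.2) :=
    ((continuous_apply i).comp continuous_fst).prodMk continuous_snd
  exact continuous_action_wps.comp h

theorem hasLocalFrame_triple {β : Fin 3 → WPS}
    (hβ : ∀ Q : O3, (∀ m, op Q • β m = β m) → Q = 1) : HasLocalFrame β := by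
  have hfree : ∀ Q : O3, edist (op Q • β) β = 0 → Q = 1 := by
    refine fun Q hQ => hβ Q fun m => ?_
    refine WPS.eq_of_edist_eq_zero (le_antisymm ?_ bot_le)
    exact (edist_le_pi_edist (op Q • β) β m).trans hQ.le
  have hact := continuous_action_pi (ι := Fin 3)
  exact hasLocalFrame_of_edist hact hfree

theorem continuous_action_pStief (n : ℕ) : Continuous fun p : PStief n × O3 => op p.2 • p.1 :=
  Continuous.subtype_mk (continuous_action_pi.comp
    ((continuous_subtype_val.comp continuous_fst).prodMk continuous_snd)) _

theorem hasLocalFrame_pStief {n : ℕ} (A : PStief n) : HasLocalFrame A := by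
  obtain ⟨i, hi⟩ := A.2.exists_triple
  refine HasLocalFrame.comap (Y := Fin 3 → WPS) (F := fun A m => A.1 (i m))
    (continuous_pi fun m => (continuous_apply (i m)).comp continuous_subtype_val)
    (fun Q A => rfl) (hasLocalFrame_triple hi)

theorem continuous_extend (n : ℕ) : Continuous (PStief.extend (n := n)) :=
  continuous_iSup_rng (i := n) continuous_coinduced_rng

theorem continuous_pStiefInf_iff {Z : Type*} [TopologicalSpace Z] {f : PStiefInf → Z} :
    Continuous f ↔ ∀ n, Continuous fun A : PStief n => f A.extend := by
  rw [continuous_iSup_dom]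
  exact forall_congr' fun n => continuous_coinduced_dom

theorem continuous_pStiefInf_apply (i : ℕ) : Continuous fun A : PStiefInf => A.1 i := by
  refine continuous_pStiefInf_iff.2 fun n => ?_
  by_cases h : i < n
  · have : (fun A : PStief n => A.extend.1 i) = fun A => A.1 ⟨i, h⟩ := by
      funext A
      exact dif_pos h
    rw [this]
    exact (continuous_apply (A := fun _ : Fin n => WPS) _).comp continuous_subtype_val
  · have : (fun A : PStief n => A.extend.1 i) = fun _ => 0 := by
      funext A
      exact dif_neg h
    rw [this]
    exact continuous_const

theorem PStiefInf.exists_extend (A : PStiefInf) : ∃ (n : ℕ) (B : PStief n), B.extend = A := by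
  obtain ⟨n, hn⟩ := A.2.1
  refine ⟨n, ⟨fun i => A.1 i, ?_, ?_⟩, ?_⟩
  · exact A.2.2.1.of_subfamily _ fun j => Or.inr ⟨j, rfl⟩
  · refine eq_empty_of_subset_empty fun x hx => ?_
    have : x ∈ commonKer (fun i => (A.1 i).aim) univ := by
      intro i _
      by_cases h : i < n
      · exact hx ⟨i, h⟩ trivial
      · simp only [hn i (not_lt.1 h)]
        rfl
    rw [show commonKer (fun i => (A.1 i).aim) univ = ∅ from A.2.2.2] at this
    exact this
  · refine Subtype.ext (funext fun i => ?_)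
    by_cases h : i < n
    · exact dif_pos h
    · exact (dif_neg h).trans (hn i (not_lt.1 h)).symm

theorem smul_extend {n : ℕ} (Q : O3) (A : PStief n) : op Q • A.extend = (op Q • A).extend := by
  refine Subtype.ext (funext fun i => ?_)
  show op Q • A.extend.1 i = _
  by_cases h : i < n
  · have h1 : A.extend.1 i = A.1 ⟨i, h⟩ := dif_pos h
    have h2 : (op Q • A).extend.1 i = (op Q • A).1 ⟨i, h⟩ := dif_pos h
    rw [h1, h2]
    rfl
  · have h1 : A.extend.1 i = 0 := dif_neg h
    have h2 : (op Q • A).extend.1 i = 0 := dif_neg h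
    rw [h1, h2]
    rfl

/-- A product with O(3) need not visibly commute with the direct limit. The action is therefore
curried into C(O(3), PV), where continuity can be tested on each finite stage, and recovered by
evaluation, which is continuous because O(3) is compact. -/
theorem continuous_action_pStiefInf : Continuous fun p : PStiefInf × O3 => op p.2 • p.1 := by
  have hfin : ∀ n, Continuous fun p : PStief n × O3 => op p.2 • p.1.extend := by
    intro n
    simp only [smul_extend]
    exact (continuous_extend n).comp (continuous_action_pStief n)
  have horb : ∀ A : PStiefInf, Continuous fun Q : O3 => op Q • A := by
    intro A
    obtain ⟨n, B, rfl⟩ := A.exists_extend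
    exact (hfin n).comp (Continuous.prodMk_right B)
  let Φ : PStiefInf → C(O3, PStiefInf) := fun A => ⟨fun Q => op Q • A, horb A⟩
  have hΦ : Continuous Φ := by
    refine continuous_pStiefInf_iff.2 fun n => ?_
    exact (ContinuousMap.curry ⟨_, hfin n⟩).continuous
  exact ContinuousEval.continuous_eval.comp ((hΦ.comp continuous_fst).prodMk continuous_snd)

theorem hasLocalFrame_pStiefInf (A : PStiefInf) : HasLocalFrame A := by
  obtain ⟨i, hi⟩ := A.2.2.exists_triple
  refine HasLocalFrame.comap (Y := Fin 3 → WPS) (F := fun A m => A.1 (i m))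
    (continuous_pi fun m => continuous_pStiefInf_apply (i m))
    (fun Q A => rfl) (hasLocalFrame_triple hi)

/-! ### Principal bundles from local equivariant maps -/

section Principal
variable {X : Type*} [TopologicalSpace X] [MulAction O3ᵐᵒᵖ X]

theorem continuousConstSMul_of_action (hact : Continuous fun p : X × O3 => op p.2 • p.1) :
    ContinuousConstSMul O3ᵐᵒᵖ X :=
  ⟨fun Q => hact.comp (Continuous.prodMk_left Q.unop)⟩

theorem HasLocalFrame.free {x : X} (h : HasLocalFrame x) {Q : O3} (hQ : op Q • x = x) : Q = 1 := by
  obtain ⟨W, u, -, hx, -, -, hequ⟩ := h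
  have := hequ Q x hx
  rw [hQ] at this
  exact mul_eq_left.1 this.symm

theorem exists_principal_trivialization (hact : Continuous fun p : X × O3 => op p.2 • p.1)
    {W : Set X} {u : X → O3} (hW : IsOpen W) (hinv : ∀ (Q : O3), ∀ z ∈ W, op Q • z ∈ W)
    (hu : ContinuousOn u W) (hequ : ∀ (Q : O3), ∀ z ∈ W, u (op Q • z) = u z * Q) :
    ∃ e : Bundle.Trivialization O3 (Quotient.mk (MulAction.orbitRel O3ᵐᵒᵖ X)),
      e.baseSet = Quotient.mk _ '' W ∧ ∀ x, (e x).2 = u x := by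
  have := continuousConstSMul_of_action hact
  have hq : IsOpenQuotientMap (Quotient.mk (MulAction.orbitRel O3ᵐᵒᵖ X)) :=
    MulAction.isOpenQuotientMap_quotientMk
  have hmem : ∀ x, Quotient.mk (MulAction.orbitRel O3ᵐᵒᵖ X) x ∈
      Quotient.mk (MulAction.orbitRel O3ᵐᵒᵖ X) '' W ↔ x ∈ W := by
    refine fun x => ⟨?_, fun hx => ⟨x, hx, rfl⟩⟩
    rintro ⟨z, hz, hzx⟩
    obtain ⟨Q, rfl⟩ : x ∈ MulAction.orbit O3ᵐᵒᵖ z := Quotient.exact hzx.symm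
    exact hinv Q.unop z hz
  -- The inverse chart moves a representative x by u(x)⁻¹g, to the unique point of its orbit with
  -- frame g; equivariance makes this independent of the representative.
  let s : Quotient (MulAction.orbitRel O3ᵐᵒᵖ X) × O3 → X := fun p =>
    op ((u p.1.out)⁻¹ * p.2) • p.1.out
  have hs : ∀ x ∈ W, ∀ g, s (Quotient.mk _ x, g) = op ((u x)⁻¹ * g) • x := by
    intro x hx g
    obtain ⟨Q, hQ⟩ : (Quotient.mk (MulAction.orbitRel O3ᵐᵒᵖ X) x).out ∈
      MulAction.orbit O3ᵐᵒᵖ x := Quotient.mk_out (s := MulAction.orbitRel O3ᵐᵒᵖ X) x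
    obtain ⟨Q, rfl⟩ := op_surjective Q
    simp only at hQ
    simp only [s, ← hQ]
    rw [hequ Q x hx, smul_smul, ← op_mul]
    congr 2
    group
  have hopen : IsOpen (Quotient.mk (MulAction.orbitRel O3ᵐᵒᵖ X) '' W) := hq.isOpenMap _ hW
  refine ⟨{
    toFun := fun x => (Quotient.mk _ x, u x)
    invFun := s
    source := Quotient.mk _ ⁻¹' (Quotient.mk _ '' W)
    target := (Quotient.mk _ '' W) ×ˢ univ
    map_source' := fun x hx => ⟨hx, trivial⟩
    map_target' := ?_
    left_inv' := ?_
    right_inv' := ?_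
    continuousOn_toFun := ?_
    continuousOn_invFun := ?_
    open_source := hopen.preimage hq.continuous
    open_target := hopen.prod isOpen_univ
    baseSet := Quotient.mk _ '' W
    open_baseSet := hopen
    source_eq := rfl
    target_eq := rfl
    proj_toFun := fun _ _ => rfl }, rfl, fun _ => rfl⟩
  · rintro ⟨_, g⟩ ⟨⟨x, hx, rfl⟩, -⟩
    rw [mem_preimage, hs x hx, hmem]
    exact hinv _ x hx
  · intro x hx
    show s (Quotient.mk _ x, u x) = x
    rw [hs x ((hmem x).1 hx), inv_mul_cancel, op_one, one_smul]
  · rintro ⟨_, g⟩ ⟨⟨x, hx, rfl⟩, -⟩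
    show (Quotient.mk _ (s (Quotient.mk _ x, g)), u (s (Quotient.mk _ x, g))) = _
    rw [hs x hx, hequ _ x hx, mul_inv_cancel_left]
    refine Prod.ext (Quotient.sound ?_) rfl
    exact ⟨op ((u x)⁻¹ * g), rfl⟩
  · refine hq.continuous.continuousOn.prodMk (hu.mono fun x hx => (hmem x).1 hx)
  · rintro ⟨_, g⟩ ⟨⟨x, hx, rfl⟩, -⟩
    refine ContinuousAt.continuousWithinAt ?_
    -- The product of an open quotient map with an identity is again one, so continuity may be
    -- checked before passing to orbits.
    have hqq := hq.prodMap (IsOpenQuotientMap.id (X := O3))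
    refine (hqq.continuousAt_comp_iff (x := (x, g))).1 ?_
    have hev : ∀ᶠ p : X × O3 in 𝓝 (x, g), p.1 ∈ W :=
      continuous_fst.continuousAt.eventually (hW.mem_nhds hx)
    have hux : ContinuousAt u x := hu.continuousAt (hW.mem_nhds hx)
    have hc : ContinuousAt (fun p : X × O3 => op ((u p.1)⁻¹ * p.2) • p.1) (x, g) := by
      refine hact.continuousAt.comp (f := fun p : X × O3 => (p.1, (u p.1)⁻¹ * p.2)) ?_
      refine continuousAt_fst.prodMk (ContinuousAt.mul (ContinuousAt.inv ?_) continuousAt_snd)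
      exact ContinuousAt.comp (f := Prod.fst) (x := (x, g)) hux continuousAt_fst
    refine hc.congr ?_
    filter_upwards [hev] with p hp
    exact (hs p.1 hp p.2).symm

/-- A continuous action of `O(3)` with local equivariant maps to `O(3)` is a locally trivial
principal bundle. -/
theorem isLocTrivPrincipalBundle (hact : Continuous fun p : X × O3 => op p.2 • p.1)
    (hframe : ∀ x : X, HasLocalFrame x) : IsLocTrivPrincipalBundle O3 X where
  continuous_action := hact
  free x g h := (hframe x).free h
  translation := by
    choose τ hτ using fun p : {p : X × X // ∃ g : O3, op g • p.1 = p.2} => p.2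
    refine ⟨τ, continuous_iff_continuousAt.2 fun p => ?_, hτ⟩
    obtain ⟨W, u, hW, hx, hinv, hu, hequ⟩ := hframe p.1.1
    have h1 : Continuous fun p : {p : X × X // ∃ g : O3, op g • p.1 = p.2} => p.1.1 :=
      continuous_fst.comp continuous_subtype_val
    have h2 : Continuous fun p : {p : X × X // ∃ g : O3, op g • p.1 = p.2} => p.1.2 :=
      continuous_snd.comp continuous_subtype_val
    have hx2 : p.1.2 ∈ W := by
      rw [← hτ p]
      exact hinv _ _ hx
    -- If B = A * Q, then u(A)⁻¹u(B) = Q, so near `p` the translation function is a continuous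
    -- expression in the frame.
    have hc : ContinuousAt (fun p : {p : X × X // ∃ g : O3, op g • p.1 = p.2} =>
        (u p.1.1)⁻¹ * u p.1.2) p := by
      refine ContinuousAt.mul (ContinuousAt.inv ?_) ?_
      · exact ContinuousAt.comp (f := fun p : {p : X × X // ∃ g : O3, op g • p.1 = p.2} => p.1.1)
          (hu.continuousAt (hW.mem_nhds hx)) h1.continuousAt
      · exact ContinuousAt.comp (f := fun p : {p : X × X // ∃ g : O3, op g • p.1 = p.2} => p.1.2)
          (hu.continuousAt (hW.mem_nhds hx2)) h2.continuousAt
    refine hc.congr ?_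
    filter_upwards [h1.continuousAt.eventually (hW.mem_nhds hx)] with q hq
    rw [← hτ q, hequ _ _ hq, inv_mul_cancel_left]
  locally_trivial b := by
    obtain ⟨x, rfl⟩ := Quotient.exists_rep b
    obtain ⟨W, u, hW, hx, hinv, hu, hequ⟩ := hframe x
    obtain ⟨e, he, heu⟩ := exists_principal_trivialization hact hW hinv hu hequ
    refine ⟨e, he ▸ ⟨x, hx, rfl⟩, fun z hz g => ?_⟩
    rw [he] at hz
    obtain ⟨y, hy, hyz⟩ := hz
    obtain ⟨Q, rfl⟩ : z ∈ MulAction.orbit O3ᵐᵒᵖ y := Quotient.exact hyz.symm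
    rw [heu, heu]
    exact hequ g _ (hinv Q.unop y hy)

end Principal

/-! ### Associated vector bundles -/

section Associated
variable {G X : Type*} [Group G] [TopologicalSpace X] [MulAction G X] [MulAction G E3]

/-- The chart is [A, x] ↦ ([A], u(A) x), with inverse ([A], y) ↦ [A, u(A)⁻¹ y]. A general group `G`
covers O(3) and SO(3) at once. -/
theorem exists_associated_trivialization [ContinuousConstSMul G X] [ContinuousConstSMul G E3]
    {p : Quotient (MulAction.orbitRel G (X × E3)) → Quotient (MulAction.orbitRel G X)}
    (hp : ∀ z : X × E3, p (Quotient.mk _ z) = Quotient.mk _ z.1)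
    {W : Set X} {u : X → O3} (hW : IsOpen W) (hinv : ∀ (g : G), ∀ z ∈ W, g • z ∈ W)
    (hu : ContinuousOn u W)
    (hequ : ∀ (g : G), ∀ z ∈ W, ∀ x : E3, mv (u (g • z)) (g • x) = mv (u z) x) :
    ∃ e : Bundle.Trivialization E3 p, e.baseSet = Quotient.mk _ '' W ∧
      ∀ A ∈ W, ∀ x, (e (Quotient.mk _ (A, x))).2 = mv (u A) x := by
  have hq : IsOpenQuotientMap (Quotient.mk (MulAction.orbitRel G X)) :=
    MulAction.isOpenQuotientMap_quotientMk
  have hq' : IsOpenQuotientMap (Quotient.mk (MulAction.orbitRel G (X × E3))) :=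
    MulAction.isOpenQuotientMap_quotientMk
  have hmem : ∀ x, Quotient.mk (MulAction.orbitRel G X) x ∈
      Quotient.mk (MulAction.orbitRel G X) '' W ↔ x ∈ W := by
    refine fun x => ⟨?_, fun hx => ⟨x, hx, rfl⟩⟩
    rintro ⟨z, hz, hzx⟩
    obtain ⟨Q, rfl⟩ : x ∈ MulAction.orbit G z := Quotient.exact hzx.symm
    exact hinv Q z hz
  have hpc : Continuous p := by
    rw [hq'.isQuotientMap.continuous_iff]
    exact (hq.continuous.comp continuous_fst).congr fun z => (hp z).symm
  let t : Quotient (MulAction.orbitRel G (X × E3)) → E3 := fun z => mv (u z.out.1) z.out.2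
  have ht : ∀ z : X × E3, z.1 ∈ W → t (Quotient.mk _ z) = mv (u z.1) z.2 := by
    intro z hz
    obtain ⟨g, hg⟩ : (Quotient.mk (MulAction.orbitRel G (X × E3)) z).out ∈
      MulAction.orbit G z := Quotient.mk_out (s := MulAction.orbitRel G (X × E3)) z
    simp only at hg
    simp only [t, ← hg]
    exact hequ g z.1 hz z.2
  let s : Quotient (MulAction.orbitRel G X) × E3 → Quotient (MulAction.orbitRel G (X × E3)) :=
    fun q => Quotient.mk _ (q.1.out, mv (u q.1.out)⁻¹ q.2)
  have hs : ∀ A ∈ W, ∀ y, s (Quotient.mk _ A, y) = Quotient.mk _ (A, mv (u A)⁻¹ y) := by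
    intro A hA y
    obtain ⟨g, hg⟩ : (Quotient.mk (MulAction.orbitRel G X) A).out ∈
      MulAction.orbit G A := Quotient.mk_out (s := MulAction.orbitRel G X) A
    simp only at hg
    simp only [s, ← hg]
    refine Quotient.sound ⟨g, Prod.ext rfl ?_⟩
    show g • mv (u A)⁻¹ y = mv (u (g • A))⁻¹ y
    have h1 := hequ g A hA (mv (u A)⁻¹ y)
    rw [← mv_mul, mul_inv_cancel, mv_one] at h1
    conv_rhs => rw [← h1, ← mv_mul, inv_mul_cancel, mv_one]
  have hopen : IsOpen (Quotient.mk (MulAction.orbitRel G X) '' W) := hq.isOpenMap _ hW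
  have hux : ∀ A ∈ W, ContinuousAt u A := fun A hA => hu.continuousAt (hW.mem_nhds hA)
  refine ⟨{
    toFun := fun z => (p z, t z)
    invFun := s
    source := p ⁻¹' (Quotient.mk _ '' W)
    target := (Quotient.mk _ '' W) ×ˢ univ
    map_source' := fun x hx => ⟨hx, trivial⟩
    map_target' := ?_
    left_inv' := ?_
    right_inv' := ?_
    continuousOn_toFun := ?_
    continuousOn_invFun := ?_
    open_source := hopen.preimage hpc
    open_target := hopen.prod isOpen_univ
    baseSet := Quotient.mk _ '' W
    open_baseSet := hopen
    source_eq := rfl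
    target_eq := rfl
    proj_toFun := fun _ _ => rfl }, rfl, fun A hA x => ht (A, x) hA⟩
  · rintro ⟨_, y⟩ ⟨⟨A, hA, rfl⟩, -⟩
    rw [mem_preimage, hs A hA, hp, hmem]
    exact hA
  · intro z hz
    obtain ⟨z, rfl⟩ := Quotient.exists_rep z
    have hz1 : z.1 ∈ W := by rwa [mem_preimage, hp, hmem] at hz
    show s (p (Quotient.mk _ z), t (Quotient.mk _ z)) = _
    rw [ht z hz1, hp, hs z.1 hz1, ← mv_mul, inv_mul_cancel, mv_one]
  · rintro ⟨_, y⟩ ⟨⟨A, hA, rfl⟩, -⟩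
    show (p (s (Quotient.mk _ A, y)), t (s (Quotient.mk _ A, y))) = _
    rw [hs A hA, hp, ht _ hA, ← mv_mul, mul_inv_cancel, mv_one]
  · intro z hz
    obtain ⟨z, rfl⟩ := Quotient.exists_rep z
    have hz1 : z.1 ∈ W := by rwa [mem_preimage, hp, hmem] at hz
    refine ContinuousAt.continuousWithinAt (hpc.continuousAt.prodMk ?_)
    refine hq'.continuousAt_comp_iff.1 ?_
    have hc : ContinuousAt (fun z : X × E3 => mv (u z.1) z.2) z := by
      refine continuous_mv.continuousAt.comp (f := fun z : X × E3 => (u z.1, z.2)) ?_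
      exact ContinuousAt.prodMk (ContinuousAt.comp (f := Prod.fst) (hux _ hz1) continuousAt_fst)
        continuousAt_snd
    refine hc.congr ?_
    filter_upwards [continuous_fst.continuousAt.eventually (hW.mem_nhds hz1)] with w hw
    exact (ht w hw).symm
  · rintro ⟨_, y⟩ ⟨⟨A, hA, rfl⟩, -⟩
    refine ContinuousAt.continuousWithinAt ?_
    have hqq := hq.prodMap (IsOpenQuotientMap.id (X := E3))
    refine (hqq.continuousAt_comp_iff (x := (A, y))).1 ?_
    have hc : ContinuousAt (fun w : X × E3 =>
        Quotient.mk (MulAction.orbitRel G (X × E3)) (w.1, mv (u w.1)⁻¹ w.2)) (A, y) := by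
      refine hq'.continuous.continuousAt.comp (f := fun w : X × E3 => (w.1, mv (u w.1)⁻¹ w.2)) ?_
      refine continuousAt_fst.prodMk ?_
      refine continuous_mv.continuousAt.comp (f := fun z : X × E3 => ((u z.1)⁻¹, z.2)) ?_
      exact ContinuousAt.prodMk (ContinuousAt.inv
        (ContinuousAt.comp (f := Prod.fst) (x := (A, y)) (hux _ hA) continuousAt_fst))
        continuousAt_snd
    have hev : ∀ᶠ w : X × E3 in 𝓝 (A, y), w.1 ∈ W :=
      continuous_fst.continuousAt.eventually (hW.mem_nhds hA)
    refine hc.congr ?_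
    filter_upwards [hev] with w hw
    exact (hs w.1 hw w.2).symm

end Associated

section Fibre
variable {G X : Type*} [Group G] [MulAction G X] [MulAction G E3]
  {p : Quotient (MulAction.orbitRel G (X × E3)) → Quotient (MulAction.orbitRel G X)}

/-- The fibre of an associated bundle over the class of `A` is parameterized by `x ↦ [A, x]`. -/
theorem bijective_fibre (hp : ∀ z : X × E3, p (Quotient.mk _ z) = Quotient.mk _ z.1)
    (hfree : ∀ (A : X) (g : G), g • A = A → g = 1) (b : Quotient (MulAction.orbitRel G X)) :
    Function.Bijective fun x : E3 => (⟨Quotient.mk _ (b.out, x), by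
      rw [mem_preimage, hp]; exact b.out_eq⟩ : p ⁻¹' {b}) := by
  constructor
  · intro x y h
    obtain ⟨g, hg⟩ : (b.out, x) ∈ MulAction.orbit G (b.out, y) :=
      Quotient.exact (congrArg Subtype.val h)
    have h1 := hfree b.out g (congrArg Prod.fst hg)
    subst h1
    simpa using (congrArg Prod.snd hg).symm
  · rintro ⟨z, hz⟩
    obtain ⟨⟨A, x⟩, rfl⟩ := Quotient.exists_rep z
    rw [mem_preimage, hp, mem_singleton_iff] at hz
    subst hz
    obtain ⟨g, hg⟩ : (Quotient.mk (MulAction.orbitRel G X) A).out ∈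
      MulAction.orbit G A := Quotient.mk_out (s := MulAction.orbitRel G X) A
    refine ⟨g • x, Subtype.ext (Quotient.sound ⟨g, Prod.ext hg rfl⟩)⟩

/-- The identification of the fibre of an associated bundle with `ℝ³` by the representative of its
base point. -/
def fibreEquiv (hp : ∀ z : X × E3, p (Quotient.mk _ z) = Quotient.mk _ z.1)
    (hfree : ∀ (A : X) (g : G), g • A = A → g = 1) (b : Quotient (MulAction.orbitRel G X)) :
    p ⁻¹' {b} ≃ E3 :=
  (Equiv.ofBijective _ (bijective_fibre hp hfree b)).symm

theorem fibreEquiv_symm_coe (hp : ∀ z : X × E3, p (Quotient.mk _ z) = Quotient.mk _ z.1)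
    (hfree : ∀ (A : X) (g : G), g • A = A → g = 1) (b : Quotient (MulAction.orbitRel G X))
    (x : E3) : ((fibreEquiv hp hfree b).symm x).1 = Quotient.mk _ (b.out, x) := rfl

/-- Replacing the chosen representative by A changes the identification of the fibre with ℝ³ by a
group element only. When that acts linearly, the linear structure does not depend on the choice. -/
theorem exists_fibreEquiv_symm_eq (hp : ∀ z : X × E3, p (Quotient.mk _ z) = Quotient.mk _ z.1)
    (hfree : ∀ (A : X) (g : G), g • A = A → g = 1) (A : X) : ∃ g : G, ∀ x : E3,
      ((fibreEquiv hp hfree (Quotient.mk _ A)).symm (g • x)).1 = Quotient.mk _ (A, x) := by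
  obtain ⟨g, hg⟩ : (Quotient.mk (MulAction.orbitRel G X) A).out ∈
    MulAction.orbit G A := Quotient.mk_out (s := MulAction.orbitRel G X) A
  exact ⟨g, fun x => Quotient.sound ⟨g, Prod.ext hg rfl⟩⟩

end Fibre

section Linear
variable {G X : Type*} [Group G] [TopologicalSpace X] [MulAction G X] [MulAction G E3]
  {p : Quotient (MulAction.orbitRel G (X × E3)) → Quotient (MulAction.orbitRel G X)}

/-- Every point of `X` has an invariant open neighborhood with a map to `O(3)` that trivializes
the associated bundle and takes values in `D`. -/
def HasAssociatedFrames (G X : Type*) [Group G] [TopologicalSpace X] [MulAction G X]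
    [MulAction G E3] (D : Set O3) : Prop :=
  ∀ A : X, ∃ (W : Set X) (u : X → O3), IsOpen W ∧ A ∈ W ∧ (∀ (g : G), ∀ z ∈ W, g • z ∈ W) ∧
    ContinuousOn u W ∧ (∀ z ∈ W, u z ∈ D) ∧
    ∀ (g : G), ∀ z ∈ W, ∀ x : E3, mv (u (g • z)) (g • x) = mv (u z) x

theorem HasAssociatedFrames.exists_trivialization [ContinuousConstSMul G X]
    [ContinuousConstSMul G E3] {D : Set O3} (h : HasAssociatedFrames G X D)
    (hp : ∀ z : X × E3, p (Quotient.mk _ z) = Quotient.mk _ z.1)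
    (hfree : ∀ (A : X) (g : G), g • A = A → g = 1) (b : Quotient (MulAction.orbitRel G X)) :
    ∃ e : Bundle.Trivialization E3 p, b ∈ e.baseSet ∧ ∀ b' ∈ e.baseSet, ∃ Q ∈ D, ∀ v : p ⁻¹' {b'},
      (e v.1).2 = orthLI Q (fibreEquiv hp hfree b' v) := by
  obtain ⟨A, rfl⟩ := Quotient.exists_rep b
  obtain ⟨W, u, hW, hA, hinv, hu, hD, hequ⟩ := h A
  obtain ⟨e, he, heu⟩ := exists_associated_trivialization hp hW hinv hu hequ
  refine ⟨e, he ▸ ⟨A, hA, rfl⟩, fun b' hb' => ?_⟩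
  rw [he] at hb'
  obtain ⟨B, hB, rfl⟩ := hb'
  obtain ⟨g, hg⟩ : (Quotient.mk (MulAction.orbitRel G X) B).out ∈
    MulAction.orbit G B := Quotient.mk_out (s := MulAction.orbitRel G X) B
  have hmem : (Quotient.mk (MulAction.orbitRel G X) B).out ∈ W := hg ▸ hinv g B hB
  refine ⟨_, hD _ hmem, fun v => ?_⟩
  obtain ⟨x, rfl⟩ := (fibreEquiv hp hfree _).symm.surjective v
  rw [fibreEquiv_symm_coe, Equiv.apply_symm_apply, heu _ hmem]
  rfl

/-- The vector bundle structure on an associated bundle. -/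
def HasAssociatedFrames.vectorBundleStr [ContinuousConstSMul G X]
    [ContinuousConstSMul G E3] {D : Set O3} (h : HasAssociatedFrames G X D)
    (hp : ∀ z : X × E3, p (Quotient.mk _ z) = Quotient.mk _ z.1)
    (hfree : ∀ (A : X) (g : G), g • A = A → g = 1) : VectorBundleStr p where
  addCommGroup b := (fibreEquiv hp hfree b).addCommGroup
  module b := (fibreEquiv hp hfree b).module ℝ
  locally_trivial b := by
    obtain ⟨e, hb, he⟩ := h.exists_trivialization hp hfree b
    refine ⟨e, hb, fun b' hb' => ?_⟩
    obtain ⟨Q, -, hQ⟩ := he b' hb'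
    let := (fibreEquiv hp hfree b').addCommGroup
    let := (fibreEquiv hp hfree b').module ℝ
    exact ⟨((fibreEquiv hp hfree b').linearEquiv ℝ).trans (orthLI Q).toLinearEquiv,
      fun v => (hQ v).symm⟩

end Linear

theorem orientation_map_trans {ι M N P : Type*} [AddCommGroup M] [AddCommGroup N]
    [AddCommGroup P] [Module ℝ M] [Module ℝ N] [Module ℝ P] (e : M ≃ₗ[ℝ] N) (f : N ≃ₗ[ℝ] P)
    (x : Orientation ℝ M ι) :
    Orientation.map ι (e.trans f) x = Orientation.map ι f (Orientation.map ι e x) := by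
  induction x using Module.Ray.ind with
  | h v hv => rfl

theorem map_orthLI_stdOr {Q : O3} (hQ : Q.1.det = 1) :
    Orientation.map (Fin 3) (orthLI Q).toLinearEquiv stdOr = stdOr := by
  rw [Orientation.map_eq_iff_det_pos _ _ (by simp)]
  have := det_orthLI Q
  rw [hQ] at this
  exact this ▸ one_pos

/-- The oriented vector bundle structure on an associated bundle. -/
def HasAssociatedFrames.orientedVectorBundleStr {G X : Type*} [Group G] [TopologicalSpace X]
    [MulAction G X] [MulAction G E3] [ContinuousConstSMul G X] [ContinuousConstSMul G E3]
    {p : Quotient (MulAction.orbitRel G (X × E3)) → Quotient (MulAction.orbitRel G X)}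
    (h : HasAssociatedFrames G X {Q | Q.1.det = 1})
    (hp : ∀ z : X × E3, p (Quotient.mk _ z) = Quotient.mk _ z.1)
    (hfree : ∀ (A : X) (g : G), g • A = A → g = 1) : OrientedVectorBundleStr p where
  toVectorBundleStr := h.vectorBundleStr hp hfree
  orientation b :=
    letI := (fibreEquiv hp hfree b).addCommGroup
    letI := (fibreEquiv hp hfree b).module ℝ
    Orientation.map (Fin 3) ((fibreEquiv hp hfree b).linearEquiv ℝ).symm stdOr
  locally_oriented b := by
    obtain ⟨e, hb, he⟩ := h.exists_trivialization hp hfree b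
    refine ⟨e, hb, fun b' hb' => ?_⟩
    obtain ⟨Q, hD, hQ⟩ := he b' hb'
    let := (fibreEquiv hp hfree b').addCommGroup
    let := (fibreEquiv hp hfree b').module ℝ
    refine ⟨((fibreEquiv hp hfree b').linearEquiv ℝ).trans (orthLI Q).toLinearEquiv,
      fun v => (hQ v).symm, ?_⟩
    refine Eq.trans ?_ (map_orthLI_stdOr hD)
    refine (orientation_map_trans _ _ _).trans (congrArg _ ?_)
    exact (Orientation.map (Fin 3) ((fibreEquiv hp hfree b').linearEquiv ℝ)).apply_symm_apply stdOr

/-! ### The canonical bundles -/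

instance : ContinuousConstSMul O3ᵐᵒᵖ E3 :=
  ⟨fun Q => continuous_mv.comp (Continuous.prodMk_right Q.unop⁻¹)⟩

section Canonical
variable {X : Type*} [TopologicalSpace X] [MulAction O3ᵐᵒᵖ X]

theorem hasAssociatedFrames_O3 (hframe : ∀ x : X, HasLocalFrame x) :
    HasAssociatedFrames O3ᵐᵒᵖ X univ := by
  intro A
  obtain ⟨W, u, hW, hA, hinv, hu, hequ⟩ := hframe A
  refine ⟨W, u, hW, hA, fun g z hz => hinv g.unop z hz, hu, fun _ _ => trivial, fun g z hz x => ?_⟩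
  have h : u (g • z) = u z * g.unop := hequ g.unop z hz
  show mv (u (g • z)) (mv g.unop⁻¹ x) = _
  rw [h, ← mv_mul, mul_inv_cancel_right]

/-- The frame is multiplied on the left by u(A)⁻¹, which does not disturb right equivariance and
makes it 1 at A. The part where its determinant is positive, hence 1, is open and SO(3)-invariant.
-/
theorem hasAssociatedFrames_SO3 (hframe : ∀ x : X, HasLocalFrame x) :
    HasAssociatedFrames SO3.op X {Q | Q.1.det = 1} := by
  intro A
  obtain ⟨W, u, hW, hA, hinv, hu, hequ⟩ := hframe A
  have hc : ContinuousOn (fun z => ((u A)⁻¹ * u z).1.det) W := by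
    have h1 : ContinuousOn (fun z => (u A)⁻¹ * u z) W := continuousOn_const.mul hu
    have h2 : Continuous fun Q : O3 => Q.1.det := continuous_subtype_val.matrix_det
    exact h2.comp_continuousOn h1
  have hequ' : ∀ (g : SO3.op), ∀ z ∈ W, u (g • z) = u z * g.1.unop :=
    fun g z hz => hequ g.1.unop z hz
  refine ⟨W ∩ {z | 0 < ((u A)⁻¹ * u z).1.det}, fun z => (u A)⁻¹ * u z,
    hc.isOpen_inter_preimage hW isOpen_Ioi, ⟨hA, ?_⟩, fun g z hz => ?_,
    (continuousOn_const.mul hu).mono inter_subset_left, fun z hz => ?_, fun g z hz x => ?_⟩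
  · show 0 < ((u A)⁻¹ * u A).1.det
    rw [inv_mul_cancel, Submonoid.coe_one, Matrix.det_one]
    exact one_pos
  · refine ⟨hinv g.1.unop z hz.1, ?_⟩
    have hg : g.1.unop.1.det = 1 := g.2
    have h0 : 0 < ((u A)⁻¹ * u z).1.det := hz.2
    show 0 < ((u A)⁻¹ * u (g • z)).1.det
    rw [hequ' g z hz.1, ← mul_assoc, Submonoid.coe_mul, Matrix.det_mul, hg, mul_one]
    exact h0
  · have h0 : 0 < ((u A)⁻¹ * u z).1.det := hz.2
    show ((u A)⁻¹ * u z).1.det = 1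
    rcases isPos_sphHomeo (orthLI ((u A)⁻¹ * u z)) with ⟨hd, -⟩ | ⟨hd, -⟩ <;> rw [det_orthLI] at hd
    · exact hd
    · linarith
  · show mv ((u A)⁻¹ * u (g • z)) (mv g.1.unop⁻¹ x) = _
    rw [hequ' g z hz.1, ← mv_mul, ← mul_assoc, mul_inv_cancel_right]

theorem xiIsVectorBundle (hact : Continuous fun p : X × O3 => op p.2 • p.1)
    (hframe : ∀ x : X, HasLocalFrame x) : XiIsVectorBundle X := by
  have := continuousConstSMul_of_action hact
  have hfree : ∀ (A : X) (g : O3ᵐᵒᵖ), g • A = A → g = 1 := fun A g hg =>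
    unop_injective ((hframe A).free (Q := g.unop) hg)
  have hp : ∀ z : X × E3, xi X (Quotient.mk _ z) = Quotient.mk _ z.1 := fun _ => rfl
  refine ⟨(hasAssociatedFrames_O3 hframe).vectorBundleStr hp hfree, fun A => ?_⟩
  obtain ⟨g, hg⟩ := exists_fibreEquiv_symm_eq hp hfree A
  let b : PGr X := Quotient.mk _ A
  let := (fibreEquiv hp hfree b).addCommGroup
  let := (fibreEquiv hp hfree b).module ℝ
  exact ⟨(orthLI g.unop⁻¹).toLinearEquiv.trans ((fibreEquiv hp hfree b).linearEquiv ℝ).symm,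
    fun x => Subtype.ext (hg x)⟩

theorem xiOrIsOrientedVectorBundle (hact : Continuous fun p : X × O3 => op p.2 • p.1)
    (hframe : ∀ x : X, HasLocalFrame x) : XiOrIsOrientedVectorBundle X := by
  have := continuousConstSMul_of_action hact
  have hc : ContinuousConstSMul SO3.op X := ⟨fun g => continuous_const_smul (g : O3ᵐᵒᵖ)⟩
  have hc' : ContinuousConstSMul SO3.op E3 := ⟨fun g => continuous_const_smul (g : O3ᵐᵒᵖ)⟩
  have hfree : ∀ (A : X) (g : SO3.op), g • A = A → g = 1 := fun A g hg =>
    Subtype.ext (unop_injective ((hframe A).free (Q := g.1.unop) hg))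
  have hp : ∀ z : X × E3, xiOr X (Quotient.mk _ z) = Quotient.mk _ z.1 := fun _ => rfl
  refine ⟨(hasAssociatedFrames_SO3 hframe).orientedVectorBundleStr hp hfree, fun A => ?_⟩
  obtain ⟨g, hg⟩ := exists_fibreEquiv_symm_eq hp hfree A
  let b : POGr X := Quotient.mk _ A
  let := (fibreEquiv hp hfree b).addCommGroup
  let := (fibreEquiv hp hfree b).module ℝ
  refine ⟨(orthLI g.1.unop⁻¹).toLinearEquiv.trans ((fibreEquiv hp hfree b).linearEquiv ℝ).symm,
    fun x => Subtype.ext (hg x), ?_⟩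
  -- The element comparing representatives lies in SO(3), so the fibre orientation does not depend
  -- on the choice either.
  have hdet : (g.1.unop⁻¹).1.det = 1 := SO3.inv_mem g.2
  exact (orientation_map_trans _ _ _).trans (congrArg _ (map_orthLI_stdOr hdet))

end Canonical

end Pseudo

end

theorem mainTheorem4 :
    (∀ n : ℕ, 3 ≤ n →
      IsLocTrivPrincipalBundle O3 (PStief n) ∧
      XiIsVectorBundle (PStief n) ∧
      XiOrIsOrientedVectorBundle (PStief n)) ∧
    (IsLocTrivPrincipalBundle O3 PStiefInf ∧
      XiIsVectorBundle PStiefInf ∧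
      XiOrIsOrientedVectorBundle PStiefInf) := by
  refine ⟨fun n _ => ⟨?_, ?_, ?_⟩, ?_, ?_, ?_⟩
  · exact isLocTrivPrincipalBundle (continuous_action_pStief n) hasLocalFrame_pStief
  · exact xiIsVectorBundle (continuous_action_pStief n) hasLocalFrame_pStief
  · exact xiOrIsOrientedVectorBundle (continuous_action_pStief n) hasLocalFrame_pStief
  · exact isLocTrivPrincipalBundle continuous_action_pStiefInf hasLocalFrame_pStiefInf
  · exact xiIsVectorBundle continuous_action_pStiefInf hasLocalFrame_pStiefInf
  · exact xiOrIsOrientedVectorBundle continuous_action_pStiefInf hasLocalFrame_pStiefInf
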